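/- Let $\gamma>0$ and let $N\ge 1$ be an integer. Put $$\alpha=\frac{\gamma}{1-e^{-\gamma}}-\frac{\gamma}{1-e^{\gamma}},\qquad \eta=\frac{-\gamma}{1-e^{-\gamma}},\qquad \beta=\frac{\gamma}{1-e^{\gamma}},$$ and let $C^\gamma\in\mathbb R^{2N\times 2N}$ be the tridiagonal matrix whose diagonal entries are $C^\gamma_{1,1}=C^\gamma_{2N,2N}=\alpha+\beta$ and $C^\gamma_{i,i}=\alpha$ for $1<i<2N$, and whose off-diagonal entries are $C^\gamma_{i,i+1}=\eta$, $C^\gamma_{i,i-1}=\beta$ in the rows $i\le N$ and $C^\gamma_{i,i+1}=\beta$, $C^\gamma_{i,i-1}=\eta$ in the rows $i\ge N+1$ (whenever the column index lies in $\{1,\dots,2N\}$). For $\theta\in\mathbb R$ let $$\mathcal C^{\theta,\gamma}=\operatorname{diag}(e^{\mathrm i\theta}I_N,\,e^{-\mathrm i\theta}I_N)\,C^\gamma\in\mathbb C^{2N\times 2N}.$$ An *exceptional point* is a parameter $\theta$ for which $\mathcal C^{\theta,\gamma}$ is not diagonalisable; an eigenvalue is *exceptional* (defective) at $\theta$ if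 its eigenspace is strictly smaller than its generalised eigenspace. A matrix is non-diagonalisable if and only if it has such an eigenvalue. A simple eigenvalue $\mu$ of $\mathcal C^{\theta_1,\gamma}$ *has passed through an exceptional point* if there are $\theta_0\in(0,\theta_1)$ and a continuous $\lambda:[\theta_0,\theta_1]\to\mathbb C$ with $\lambda(\theta_1)=\mu$ and $\lambda(\theta)$ an eigenvalue of $\mathcal C^{\theta,\gamma}$ for all $\theta\in[\theta_0,\theta_1]$, which is the only continuous function with these properties on $[\theta_0,\theta_1]$, such that $\lambda(\theta)$ is not exceptional for $\theta\in(\theta_0,\theta_1]$ but $\lambda(\theta_0)$ is exceptional at $\theta_0$. Then the following hold. 1. Counted with algebraic multiplicity, the $2N$ eigenvalues of $\mathcal C^{\pi/2,\gamma}$ are $0$, with multiplicity exactly two, and $2N-2$ further eigenvalues, which are pairwise distinct, nonzero and purely imaginary. Each of these $2N-2$ eigenvalues has passed through an exceptional point as $\theta$ goes from $0$ to $\pi/2$. 2. The remaining two eigenvalues coalesce at $0$ exactly at $\theta=\pi/2$: the parameter $\theta=\pi/2$ is an exceptional point and $0$ is an exceptional eigenvalue there; $0$ is a simple eigenvalue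 of $\mathcal C^{\theta,\gamma}$ for $0\le\theta<\pi/2$; and for some $\theta_0\in[0,\pi/2)$ there is a continuous $q:[\theta_0,\pi/2]\to\mathbb C$ such that $q(\theta)$ is an eigenvalue of $\mathcal C^{\theta,\gamma}$ for all $\theta\in[\theta_0,\pi/2]$, $q(\theta)\neq 0$ for $\theta<\pi/2$, and $q(\pi/2)=0$. -/

import Mathlib

noncomputable section

namespace GaugeCapacitance

/-- `α = γ / (1 - e^{-γ}) - γ / (1 - e^{γ})`. -/
def alpha (γ : ℝ) : ℝ := γ / (1 - Real.exp (-γ)) - γ / (1 - Real.exp γ)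

/-- `η = -γ / (1 - e^{-γ})`. -/
def eta (γ : ℝ) : ℝ := -γ / (1 - Real.exp (-γ))

/-- `β = γ / (1 - e^{γ})`. -/
def beta (γ : ℝ) : ℝ := γ / (1 - Real.exp γ)

/-- The real `2N × 2N` gauge capacitance matrix `C^γ`, rows and columns being numbered from `0`.
It is tridiagonal.  The diagonal is `α`, except for the two corner entries `α + β`.  In the first
`N` rows the entries left and right of the diagonal are `β` and `η`; in the last `N` rows they are
`η` and `β`. -/
def gaugeCapacitanceMatrix (N : ℕ) (γ : ℝ) : Matrix (Fin (2 * N)) (Fin (2 * N)) ℝ :=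
  Matrix.of fun i j =>
    if (i : ℕ) = j then
      if (i : ℕ) = 0 ∨ (i : ℕ) + 1 = 2 * N then alpha γ + beta γ else alpha γ
    else if (j : ℕ) = i + 1 then
      if (i : ℕ) < N then eta γ else beta γ
    else if (i : ℕ) = j + 1 then
      if (i : ℕ) < N then beta γ else eta γ
    else 0

/-- The matrix `V^θ = diag(e^{iθ} I_N, e^{-iθ} I_N)` of the material parameters. -/
def materialMatrix (N : ℕ) (θ : ℝ) : Matrix (Fin (2 * N)) (Fin (2 * N)) ℂ :=
  Matrix.diagonal fun i =>
    if (i : ℕ) < N then Complex.exp (Complex.I * θ) else Complex.exp (-(Complex.I * θ))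

/-- The generalised gauge capacitance matrix `C^{θ,γ} = V^θ C^γ`. -/
def genCapacitanceMatrix (N : ℕ) (θ γ : ℝ) : Matrix (Fin (2 * N)) (Fin (2 * N)) ℂ :=
  materialMatrix N θ * (gaugeCapacitanceMatrix N γ).map (fun x : ℝ => (x : ℂ))

/-- A square complex matrix is diagonalisable if `A P = P diag(d)` for an invertible `P`. -/
def IsDiagonalisable {n : Type*} [Fintype n] [DecidableEq n] (A : Matrix n n ℂ) : Prop :=
  ∃ (P : Matrix n n ℂ) (d : n → ℂ), IsUnit P ∧ A * P = P * Matrix.diagonal d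

/-- `μ` is a defective eigenvalue of `A`: its eigenspace is strictly smaller than its generalised
eigenspace, so that eigenvectors have coalesced at `μ`. -/
def IsDefectiveEigenvalue {n : Type*} [Fintype n] [DecidableEq n] (A : Matrix n n ℂ) (μ : ℂ) :
    Prop :=
  Module.End.eigenspace (Matrix.toLin' A) μ < Module.End.maxGenEigenspace (Matrix.toLin' A) μ

/-- A matrix is non-diagonalisable exactly when it has a defective eigenvalue. -/
theorem not_isDiagonalisable_iff {n : Type*} [Fintype n] [DecidableEq n] (A : Matrix n n ℂ) :
    ¬ IsDiagonalisable A ↔ ∃ μ, IsDefectiveEigenvalue A μ := by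
  constructor
  · intro h
    by_contra! hd
    apply h
    set f : Module.End ℂ (n → ℂ) := Matrix.toLin' A with hf
    have heq : ∀ μ, f.maxGenEigenspace μ = f.eigenspace μ := by
      intro μ
      have hle : f.eigenspace μ ≤ f.maxGenEigenspace μ :=
        (f.genEigenspace μ).monotone le_top
      by_contra hne
      exact hd μ (lt_of_le_of_ne hle (Ne.symm hne))
    have htop : ⨆ μ, f.eigenspace μ = ⊤ := by
      rw [← Module.End.iSup_maxGenEigenspace_eq_top f]
      simp only [heq]
    have hint : DirectSum.IsInternal f.eigenspace :=
      (DirectSum.isInternal_submodule_iff_iSupIndep_and_iSup_eq_top _).2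
        ⟨f.eigenspaces_iSupIndep, htop⟩
    let b₀ := hint.collectedBasis (fun μ => Module.finBasis ℂ (f.eigenspace μ))
    have hfin : Fintype (Σ μ : ℂ, Fin (Module.finrank ℂ (f.eigenspace μ))) :=
      FiniteDimensional.fintypeBasisIndex b₀
    have hcard : Nonempty ((Σ μ : ℂ, Fin (Module.finrank ℂ (f.eigenspace μ))) ≃ n) := by
      rw [← Fintype.card_eq, ← Module.finrank_eq_card_basis b₀, Module.finrank_fintype_fun_eq_card]
    obtain ⟨e⟩ := hcard
    let b := b₀.reindex e
    have hb : ∀ j, f (b j) = (e.symm j).1 • b j := by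
      intro j
      have hm : b j ∈ f.eigenspace (e.symm j).1 := by
        simp only [b, Module.Basis.reindex_apply]
        exact hint.collectedBasis_mem _ _
      exact Module.End.mem_eigenspace_iff.1 hm
    refine ⟨Matrix.of fun i j => b j i, fun j => (e.symm j).1, ?_, ?_⟩
    · have : (Matrix.of fun i j => b j i) = (Pi.basisFun ℂ n).toMatrix b := by
        ext i j
        simp [Module.Basis.toMatrix_apply]
      rw [this]
      have := (Pi.basisFun ℂ n).invertibleToMatrix b
      exact isUnit_of_invertible _
    · ext i j
      have h0 : f (b j) = A.mulVec (b j) := Matrix.toLin'_apply A (b j)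
      have := congrFun (h0.symm.trans (hb j)) i
      rw [Matrix.mul_diagonal]
      simp only [Matrix.mul_apply, Matrix.of_apply]
      simp only [Matrix.mulVec, dotProduct, Pi.smul_apply, smul_eq_mul] at this
      rw [this, mul_comm]
  · rintro ⟨μ, hμ⟩ ⟨P, d, hP, hAP⟩
    refine hμ.not_ge fun v hv => ?_
    obtain ⟨k, hk⟩ := (Module.End.mem_maxGenEigenspace _ _ _).1 hv
    obtain ⟨u, rfl⟩ := hP
    set Q : Matrix n n ℂ := ((u⁻¹ : (Matrix n n ℂ)ˣ) : Matrix n n ℂ) with hQ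
    have hPQ : (u : Matrix n n ℂ) * Q = 1 := by rw [hQ, Units.mul_inv]
    have hcomm : ∀ w : n → ℂ, (Matrix.toLin' A - μ • (1 : Module.End ℂ (n → ℂ)))
        ((u : Matrix n n ℂ).mulVec w) =
        (u : Matrix n n ℂ).mulVec (fun i => (d i - μ) * w i) := by
      intro w
      have h1 : (fun i => (d i - μ) * w i) = (Matrix.diagonal d).mulVec w - μ • w := by
        ext i
        simp [Matrix.mulVec_diagonal, sub_mul]
      rw [h1, Matrix.mulVec_sub, Matrix.mulVec_mulVec, ← hAP, Matrix.mulVec_smul]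
      simp [Matrix.mulVec_mulVec]
    have hpow : ∀ (m : ℕ) (w : n → ℂ), ((Matrix.toLin' A - μ • (1 : Module.End ℂ (n → ℂ))) ^ m)
        ((u : Matrix n n ℂ).mulVec w) =
        (u : Matrix n n ℂ).mulVec (fun i => (d i - μ) ^ m * w i) := by
      intro m
      induction m with
      | zero => intro w; simp
      | succ m ih =>
        intro w
        rw [pow_succ, Module.End.mul_apply, hcomm, ih]
        congr 1
        ext i
        ring
    have hinj : Function.Injective ((u : Matrix n n ℂ).mulVec) :=
      Matrix.mulVec_injective_of_isUnit u.isUnit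
    have hvw : v = (u : Matrix n n ℂ).mulVec (Q.mulVec v) := by
      rw [Matrix.mulVec_mulVec, hPQ, Matrix.one_mulVec]
    rw [hvw, hpow, ← Matrix.mulVec_zero (u : Matrix n n ℂ)] at hk
    have hk' := hinj hk
    rw [Module.End.mem_eigenspace_iff, ← sub_eq_zero]
    have h2 := hcomm (Q.mulVec v)
    rw [← hvw] at h2
    have h3 : (fun i => (d i - μ) * Q.mulVec v i) = 0 := by
      ext i
      have h4 := congrFun hk' i
      simp only [Pi.zero_apply, mul_eq_zero] at h4 ⊢
      rcases h4 with h4 | h4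
      · left
        exact pow_eq_zero_iff (by rintro rfl; simp at h4) |>.1 h4
      · exact Or.inr h4
    rw [h3, Matrix.mulVec_zero] at h2
    simpa using h2

/-- The parameter `θ` is an exceptional point if `C^{θ,γ}` is not diagonalisable. -/
def IsExceptionalPoint (N : ℕ) (γ θ : ℝ) : Prop :=
  ¬ IsDiagonalisable (genCapacitanceMatrix N θ γ)

/-- The algebraic multiplicity of `μ` as an eigenvalue of `C^{θ,γ}`. -/
def algMultiplicity (N : ℕ) (γ θ : ℝ) (μ : ℂ) : ℕ :=
  (genCapacitanceMatrix N θ γ).charpoly.rootMultiplicity μ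

/-- `p` is a continuous path of eigenvalues of `C^{θ,γ}` over `θ₀ ≤ θ ≤ θ₁`, ending in `μ` at
`θ₁`. -/
structure IsEigenvaluePath (N : ℕ) (γ θ₀ θ₁ : ℝ) (μ : ℂ) (p : ℝ → ℂ) : Prop where
  continuousOn : ContinuousOn p (Set.Icc θ₀ θ₁)
  hasEigenvalue : ∀ θ ∈ Set.Icc θ₀ θ₁,
    Module.End.HasEigenvalue (Matrix.toLin' (genCapacitanceMatrix N θ γ)) (p θ)
  endpoint : p θ₁ = μ

/-- The simple eigenvalue `μ` of `C^{θ₁,γ}` has passed through an exceptional point as the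
parameter grew from `0` to `θ₁`: the path of eigenvalues that ends in `μ` at `θ₁`, followed
backwards from `θ₁`, is uniquely determined until it meets an exceptional point (a defective
eigenvalue), and this happens at some `θ₀` with `0 < θ₀ < θ₁`. -/
def HasPassedThroughExceptionalPoint (N : ℕ) (γ θ₁ : ℝ) (μ : ℂ) : Prop :=
  algMultiplicity N γ θ₁ μ = 1 ∧
  ∃ θ₀ : ℝ, 0 < θ₀ ∧ θ₀ < θ₁ ∧
    ∃ p : ℝ → ℂ, IsEigenvaluePath N γ θ₀ θ₁ μ p ∧
      (∀ q : ℝ → ℂ, IsEigenvaluePath N γ θ₀ θ₁ μ q → Set.EqOn q p (Set.Icc θ₀ θ₁)) ∧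
      (∀ θ ∈ Set.Ioc θ₀ θ₁, ¬ IsDefectiveEigenvalue (genCapacitanceMatrix N θ γ) (p θ)) ∧
      IsDefectiveEigenvalue (genCapacitanceMatrix N θ₀ γ) (p θ₀)

end GaugeCapacitance

end

/-! Write `A = V C` with `C` the gauge matrix and `V` the diagonal matrix of phases. Two facts about
`C` carry the argument. Its rows sum to zero, and since `η = e^γ β` the weights of `gaugeWeight`
make it self-adjoint for `weightedInner`. Hence `⟨x, C x⟩` is a Dirichlet form with nonnegative
conductances on a path, which vanishes only on constants (`eq_const_of_weightedInner_eq_zero`).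
Moreover `C` is tridiagonal with nonzero superdiagonal, so eigenspaces have dimension at most one
and a defective eigenvalue is the same as a multiple root of the characteristic polynomial
(`isDefectiveEigenvalue_iff`).

At `θ = 0` the matrix is self-adjoint, so its eigenvalues are real and simple. At `θ = π/2` one has
`V⁻¹ = -V`, so `A` is skew for the semidefinite form `⟨x, C y⟩` (`dirichlet_skew`); nonzero
eigenvalues are therefore imaginary and simple, while `0` carries a Jordan chain of length exactly
two.

Reversing the indices and conjugating preserves the family, so every spectrum is closed under
conjugation. Follow a nonzero eigenvalue backwards from `π/2` as long as it stays simple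
(`exists_maximal_root_path`). If it stayed simple down to `θ = 0`, it would be real there; the path
and its conjugate would agree at `0`, hence everywhere by uniqueness of simple root paths, and its
value at `π/2` would be both real and imaginary. So simplicity fails at some positive `θ₀`, which is
the exceptional point.

For `cos θ > 0` the eigenvalue `0` is simple, because `A x = c·1` forces `c` times a weighted sum of
phases with positive real part to vanish. After division by `X`, the characteristic polynomial has a
simple root `0` at `π/2`; the implicit function theorem continues it to the path that meets `0`. -/

namespace GaugeCapacitance

open Polynomial Filter Topology Set

/-! ### Continuation and limits of roots of a family of polynomials -/

section RootPaths

variable {p : ℝ → ℂ[X]} {n : ℕ}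

theorem contDiff_eval (hp : ∀ k, ContDiff ℝ 1 fun θ => (p θ).coeff k)
    (hn : ∀ θ, (p θ).natDegree ≤ n) :
    ContDiff ℝ 1 fun v : ℝ × ℂ => (p v.1).eval v.2 := by
  have : (fun v : ℝ × ℂ => (p v.1).eval v.2) =
      fun v => ∑ i ∈ Finset.range (n + 1), (p v.1).coeff i * v.2 ^ i := by
    ext v
    exact eval_eq_sum_range' (Nat.lt_succ_of_le (hn v.1)) v.2
  rw [this]
  refine ContDiff.sum fun i _ => ?_
  exact ((hp i).comp contDiff_fst).mul (contDiff_snd.pow i)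

theorem continuous_eval_derivative (hp : ∀ k, ContDiff ℝ 1 fun θ => (p θ).coeff k)
    (hn : ∀ θ, (p θ).natDegree ≤ n) :
    Continuous fun v : ℝ × ℂ => (derivative (p v.1)).eval v.2 := by
  refine (contDiff_eval (p := fun θ => derivative (p θ)) (n := n) (fun k => ?_)
    fun θ => ?_).continuous
  · simp only [coeff_derivative]
    exact (hp (k + 1)).mul contDiff_const
  · exact (natDegree_derivative_le _).trans ((Nat.sub_le _ _).trans (hn θ))

/-- A simple root of a continuously differentiable family of polynomials can be continued, and the
continuation is the only root nearby. -/
theorem exists_local_root (hp : ∀ k, ContDiff ℝ 1 fun θ => (p θ).coeff k)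
    (hn : ∀ θ, (p θ).natDegree ≤ n) {θ₀ : ℝ} {r : ℂ} (h0 : (p θ₀).eval r = 0)
    (h1 : (derivative (p θ₀)).eval r ≠ 0) :
    ∃ φ : ℝ → ℂ, (∀ᶠ θ in 𝓝 θ₀, ContinuousAt φ θ) ∧ φ θ₀ = r ∧
      ∀ᶠ v : ℝ × ℂ in 𝓝 (θ₀, r), (p v.1).eval v.2 = 0 ↔ φ v.1 = v.2 := by
  set f : ℝ × ℂ → ℂ := fun v => (p v.1).eval v.2 with hf
  have cdf : ContDiffAt ℝ 1 f (θ₀, r) := (contDiff_eval hp hn).contDiffAt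
  have hd : HasFDerivAt f (fderiv ℝ f (θ₀, r)) (θ₀, r) :=
    (cdf.differentiableAt one_ne_zero).hasFDerivAt
  have hpart : HasFDerivAt (fun z : ℂ => (p θ₀).eval z)
      (fderiv ℝ f (θ₀, r) ∘L .inr ℝ ℝ ℂ) r := by
    have h2 : HasFDerivAt (fun z : ℂ => ((θ₀, z) : ℝ × ℂ)) (.inr ℝ ℝ ℂ) r :=
      hasFDerivAt_prodMk_right θ₀ r
    exact HasFDerivAt.comp r hd h2
  have hpart' : HasFDerivAt (fun z : ℂ => (p θ₀).eval z)
      ((ContinuousLinearMap.toSpanSingleton ℂ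
        ((derivative (p θ₀)).eval r)).restrictScalars ℝ) r :=
    ((p θ₀).hasDerivAt r).hasFDerivAt.restrictScalars ℝ
  -- The partial derivative in the root variable is complex multiplication by `p'(r) ≠ 0`, an
  -- `ℝ`-linear automorphism of `ℂ`.
  have hinv : (fderiv ℝ f (θ₀, r) ∘L .inr ℝ ℝ ℂ).IsInvertible := by
    rw [hpart.unique hpart']
    refine ⟨((ContinuousLinearEquiv.unitsEquivAut ℂ)
      (Units.mk0 _ h1)).restrictScalars ℝ, ?_⟩
    ext; simp
  refine ⟨cdf.implicitFunction one_ne_zero hinv, ?_,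
    cdf.implicitFunction_apply_self one_ne_zero hinv, ?_⟩
  · filter_upwards [(cdf.contDiffAt_implicitFunction one_ne_zero hinv).eventually (by simp)]
      with θ hθ using hθ.continuousAt
  · filter_upwards [cdf.eventually_apply_eq_iff_implicitFunction one_ne_zero hinv] with v hv
    rw [← hv]
    simp [hf, h0]

/-- A path of simple roots is determined by its value at one point. -/
theorem eqOn_of_simple_roots (hp : ∀ k, ContDiff ℝ 1 fun θ => (p θ).coeff k)
    (hn : ∀ θ, (p θ).natDegree ≤ n) {I : Set ℝ} (hI : IsPreconnected I) {q₁ q₂ : ℝ → ℂ}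
    (hc₁ : ContinuousOn q₁ I) (hc₂ : ContinuousOn q₂ I)
    (hr₁ : ∀ θ ∈ I, (p θ).eval (q₁ θ) = 0) (hr₂ : ∀ θ ∈ I, (p θ).eval (q₂ θ) = 0)
    (hs : ∀ θ ∈ I, (derivative (p θ)).eval (q₁ θ) ≠ 0) {θ₁ : ℝ} (hθ₁ : θ₁ ∈ I)
    (h : q₁ θ₁ = q₂ θ₁) : EqOn q₁ q₂ I := by
  have := Subtype.preconnectedSpace hI
  have hc₁' : Continuous fun x : I => q₁ x := continuousOn_iff_continuous_domRestrict.1 hc₁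
  have hc₂' : Continuous fun x : I => q₂ x := continuousOn_iff_continuous_domRestrict.1 hc₂
  -- Near a point of agreement both paths must follow the one implicit function, so the agreement
  -- set is open; simplicity is needed along `q₁` only.
  have hclopen : IsClopen {x : I | q₁ x = q₂ x} := by
    refine ⟨isClosed_eq hc₁' hc₂', isOpen_iff_mem_nhds.2 fun x hx => ?_⟩
    obtain ⟨φ, -, -, hφ⟩ := exists_local_root hp hn (hr₁ x x.2) (hs x x.2)
    have t₁ : Tendsto (fun y : I => ((y : ℝ), q₁ y)) (𝓝 x) (𝓝 ((x : ℝ), q₁ x)) :=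
      (continuous_subtype_val.prodMk hc₁').tendsto x
    have t₂ : Tendsto (fun y : I => ((y : ℝ), q₂ y)) (𝓝 x) (𝓝 ((x : ℝ), q₁ x)) := by
      rw [show q₁ x = q₂ x from hx]
      exact (continuous_subtype_val.prodMk hc₂').tendsto x
    filter_upwards [t₁.eventually hφ, t₂.eventually hφ] with y h₁ h₂
    exact (h₁.1 (hr₁ y y.2)).symm.trans (h₂.1 (hr₂ y y.2))
  intro θ hθ
  have := hclopen.eq_univ ⟨⟨θ₁, hθ₁⟩, h⟩
  exact (this ▸ mem_univ _ : (⟨θ, hθ⟩ : I) ∈ {x : I | q₁ x = q₂ x})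

/-- A bounded path of roots over `(a, b]` has a limit at `a`, which is again a root. -/
theorem exists_tendsto_root (hf : Continuous fun v : ℝ × ℂ => (p v.1).eval v.2) {a b B : ℝ}
    (hab : a < b) (hpa : p a ≠ 0) {q : ℝ → ℂ} (hc : ContinuousOn q (Ioc a b))
    (hr : ∀ θ ∈ Ioc a b, (p θ).eval (q θ) = 0) (hB : ∀ θ ∈ Ioc a b, ‖q θ‖ ≤ B) :
    ∃ r, (p a).eval r = 0 ∧ Tendsto q (𝓝[>] a) (𝓝 r) := by
  have hIoc : ∀ᶠ θ in 𝓝[>] a, θ ∈ Ioc a b := Ioc_mem_nhdsGT hab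
  have hroot : ∀ r, ClusterPt r (map q (𝓝[>] a)) → (p a).eval r = 0 := by
    intro r hr'
    obtain ⟨U, hU, hUr⟩ := mapClusterPt_iff_ultrafilter.1 hr'
    have t : Tendsto (fun θ => (θ, q θ)) U (𝓝 (a, r)) := by
      rw [nhds_prod_eq]
      exact Tendsto.prodMk (tendsto_id.mono_right (hU.trans inf_le_left)) hUr
    refine tendsto_nhds_unique ((hf.tendsto (a, r)).comp t) ?_
    refine tendsto_const_nhds.congr' ?_
    filter_upwards [hIoc.filter_mono hU] with θ hθ using (hr θ hθ).symm
  obtain ⟨r, -, hcl⟩ := (isCompact_closedBall (0 : ℂ) B).exists_clusterPt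
    (f := map q (𝓝[>] a)) (by
      rw [le_principal_iff, mem_map]
      filter_upwards [hIoc] with θ hθ
      simpa using hB θ hθ)
  refine ⟨r, hroot r hcl, ?_⟩
  rw [Metric.tendsto_nhds]
  intro ε hε
  -- The finitely many roots of `p a` leave a radius below `ε` whose sphere around `r` contains none
  -- of them. A path returning to that sphere arbitrarily close to `a` would have a cluster point,
  -- hence a root, on it. So the path eventually avoids the sphere, and connectedness keeps it
  -- inside.
  obtain ⟨δ, ⟨hδ0, hδε⟩, hδ⟩ : ∃ δ ∈ Ioo 0 ε, δ ∉ (fun z => dist z r) '' {z | (p a).eval z = 0} := by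
    have hfin : ((fun z => dist z r) '' {z | (p a).eval z = 0}).Finite := by
      refine Set.Finite.image _ ?_
      refine ((p a).roots.toFinset.finite_toSet).subset fun z hz => ?_
      simpa [hpa] using hz
    exact ((Ioo_infinite hε).sdiff hfin).nonempty.imp fun δ h => h
  have hsphere : ∀ᶠ θ in 𝓝[>] a, dist (q θ) r ≠ δ := by
    by_contra hnot
    have hfreq : ∃ᶠ θ in 𝓝[>] a, q θ ∈ Metric.sphere r δ := hnot
    obtain ⟨s, hs, hcs⟩ := (isCompact_sphere r δ).exists_clusterPt_of_frequently
      (l := map q (𝓝[>] a)) hfreq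
    exact hδ ⟨s, hroot s hcs, hs⟩
  obtain ⟨c, hac, hcs⟩ := (mem_nhdsGT_iff_exists_Ioc_subset).1 (hsphere.and hIoc)
  have hcb : ContinuousOn (fun θ => dist (q θ) r) (Ioc a c) :=
    continuous_dist.comp_continuousOn
      ((hc.mono fun θ hθ => (hcs hθ).2).prodMk continuousOn_const)
  have hlt : ∃ θ ∈ Ioc a c, dist (q θ) r < δ := by
    have h1 : ∃ᶠ θ in 𝓝[>] a, q θ ∈ Metric.ball r δ :=
      hcl.frequently (Metric.ball_mem_nhds r hδ0)
    obtain ⟨θ, h2, h3⟩ := (h1.and_eventually (Ioc_mem_nhdsGT hac)).exists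
    exact ⟨θ, h3, h2⟩
  obtain ⟨θ₁, hθ₁, hlt₁⟩ := hlt
  filter_upwards [Ioc_mem_nhdsGT hac] with θ hθ
  refine lt_trans ?_ hδε
  by_contra! hge
  obtain ⟨x, hx, hxδ⟩ := isPreconnected_Ioc.intermediate_value hθ₁ hθ hcb ⟨hlt₁.le, hge⟩
  exact (hcs hx).1 hxδ

end RootPaths

/-- `q` is a continuous path over `I` of simple roots of the family `p`. -/
structure IsSimpleRootPath (p : ℝ → ℂ[X]) (I : Set ℝ) (q : ℝ → ℂ) : Prop where
  continuousOn : ContinuousOn q I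
  eval_eq_zero : ∀ θ ∈ I, (p θ).eval (q θ) = 0
  simple : ∀ θ ∈ I, (derivative (p θ)).eval (q θ) ≠ 0

/-! ### Backward continuation as long as the root is simple -/

section RootPaths

variable {p : ℝ → ℂ[X]} {n : ℕ}

theorem IsSimpleRootPath.mono {I J : Set ℝ} {q : ℝ → ℂ} (h : IsSimpleRootPath p I q)
    (hJ : J ⊆ I) : IsSimpleRootPath p J q :=
  ⟨h.1.mono hJ, fun θ hθ => h.2 θ (hJ hθ), fun θ hθ => h.3 θ (hJ hθ)⟩

/-- A path of simple roots over `[s, b]` extends beyond `s`. -/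
theorem IsSimpleRootPath.exists_extension (hp : ∀ k, ContDiff ℝ 1 fun θ => (p θ).coeff k)
    (hn : ∀ θ, (p θ).natDegree ≤ n) {s b : ℝ} (hsb : s ≤ b) {q : ℝ → ℂ}
    (h : IsSimpleRootPath p (Icc s b) q) :
    ∃ s' < s, ∃ q', IsSimpleRootPath p (Icc s' b) q' ∧ q' b = q b := by
  have hs : s ∈ Icc s b := left_mem_Icc.2 hsb
  obtain ⟨φ, hφc, hφs, hφ⟩ := exists_local_root hp hn (h.eval_eq_zero s hs) (h.simple s hs)
  have t : Tendsto (fun θ => (θ, φ θ)) (𝓝 s) (𝓝 (s, q s)) := by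
    have := (continuousAt_id.prodMk hφc.self_of_nhds).tendsto
    simpa [hφs] using this
  have hev : ∀ᶠ θ in 𝓝 s, ContinuousAt φ θ ∧ (p θ).eval (φ θ) = 0 ∧
      (derivative (p θ)).eval (φ θ) ≠ 0 := by
    filter_upwards [hφc, t.eventually hφ, t.eventually
      ((continuous_eval_derivative hp hn).continuousAt.eventually_ne (h.simple s hs))]
      with θ h₁ h₂ h₃ using ⟨h₁, h₂.2 rfl, h₃⟩
  obtain ⟨l, hl, hls⟩ := (mem_nhdsLE_iff_exists_Icc_subset).1 (hev.filter_mono nhdsWithin_le_nhds)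
  obtain ⟨q', hq'⟩ : ∃ q' : ℝ → ℂ, q' = fun θ => if θ ≤ s then φ θ else q θ := ⟨_, rfl⟩
  have e₁ : ∀ θ ∈ Icc l s, q' θ = φ θ := fun θ hθ => by rw [hq']; exact if_pos hθ.2
  have e₂ : ∀ θ ∈ Icc s b, q' θ = q θ := fun θ hθ => by
    rw [hq']
    rcases hθ.1.eq_or_lt with rfl | hlt
    · simp [hφs]
    · simp [hlt]
  have hun : Icc l b = Icc l s ∪ Icc s b := (Icc_union_Icc_eq_Icc hl.le hsb).symm
  refine ⟨l, hl, q', ⟨?_, ?_, ?_⟩, e₂ b (right_mem_Icc.2 hsb)⟩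
  · rw [hun]
    refine ContinuousOn.union_of_isClosed ?_ ?_ isClosed_Icc isClosed_Icc
    · exact ContinuousOn.congr (fun θ hθ => (hls hθ).1.continuousWithinAt) e₁
    · exact h.continuousOn.congr e₂
  · rw [hun]
    rintro θ (hθ | hθ)
    · rw [e₁ θ hθ]; exact (hls hθ).2.1
    · rw [e₂ θ hθ]; exact h.eval_eq_zero θ hθ
  · rw [hun]
    rintro θ (hθ | hθ)
    · rw [e₁ θ hθ]; exact (hls hθ).2.2
    · rw [e₂ θ hθ]; exact h.simple θ hθ

/-- A simple root at `b` can be continued backwards until it stops being simple, or until the left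
endpoint `a` is reached. -/
theorem exists_maximal_root_path (hp : ∀ k, ContDiff ℝ 1 fun θ => (p θ).coeff k)
    (hn : ∀ θ, (p θ).natDegree ≤ n) (hp0 : ∀ θ, p θ ≠ 0) {a b B : ℝ} (hab : a < b)
    (hB : ∀ θ z, (p θ).eval z = 0 → ‖z‖ ≤ B) {μ : ℂ} (h0 : (p b).eval μ = 0)
    (h1 : (derivative (p b)).eval μ ≠ 0) :
    ∃ θ₀ ∈ Ico a b, ∃ q : ℝ → ℂ, ContinuousOn q (Icc θ₀ b) ∧ (p θ₀).eval (q θ₀) = 0 ∧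
      IsSimpleRootPath p (Ioc θ₀ b) q ∧ q b = μ ∧
      (θ₀ = a ∨ (derivative (p θ₀)).eval (q θ₀) = 0) := by
  set T : Set ℝ := {s | a ≤ s ∧ s ≤ b ∧ ∃ q, IsSimpleRootPath p (Icc s b) q ∧ q b = μ} with hT
  have hext : ∀ s ≤ b, a < s → (∃ q, IsSimpleRootPath p (Icc s b) q ∧ q b = μ) →
      ∃ s' ∈ T, s' < s := by
    rintro s hsb has ⟨q, hq, hqb⟩
    obtain ⟨s', hs', q', hq', hb'⟩ := hq.exists_extension hp hn hsb
    exact ⟨max a s', ⟨le_max_left _ _, max_le hab.le (hs'.le.trans hsb), q',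
      hq'.mono (Icc_subset_Icc_left (le_max_right _ _)), hb'.trans hqb⟩, max_lt has hs'⟩
  have hTb : ∃ s ∈ T, s < b := by
    refine hext b le_rfl hab ⟨fun _ => μ, ⟨continuousOn_const, ?_, ?_⟩, rfl⟩
    · simpa using h0
    · simpa using h1
  have hbdd : BddBelow T := ⟨a, fun s hs => hs.1⟩
  have hne : T.Nonempty := hTb.imp fun s hs => hs.1
  set s₀ := sInf T with hs₀
  have has₀ : a ≤ s₀ := le_csInf hne fun s hs => hs.1
  have hs₀b : s₀ < b := by
    obtain ⟨s, hs, hsb⟩ := hTb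
    exact (csInf_le hbdd hs).trans_lt hsb
  -- One path is chosen for each starting point, with a junk value off `T`. By uniqueness they agree
  -- on overlaps, so the diagonal `θ ↦ Q θ θ` glues them over `(s₀, b]`.
  have hex : ∀ s, ∃ q, s ∈ T → IsSimpleRootPath p (Icc s b) q ∧ q b = μ := fun s => by
    by_cases hs : s ∈ T
    · exact hs.2.2.imp fun q hq _ => hq
    · exact ⟨0, fun h => (hs h).elim⟩
  choose Q hQ using hex
  have hup : ∀ s ∈ T, ∀ θ, s ≤ θ → θ ≤ b → θ ∈ T := fun s hs θ hsθ hθb =>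
    ⟨hs.1.trans hsθ, hθb, Q s, (hQ s hs).1.mono (Icc_subset_Icc_left hsθ), (hQ s hs).2⟩
  have heq : ∀ s ∈ T, EqOn (fun θ => Q θ θ) (Q s) (Icc s b) := fun s hs θ hθ => by
    obtain ⟨h₁, h₁b⟩ := hQ θ (hup s hs θ hθ.1 hθ.2)
    obtain ⟨h₂, h₂b⟩ := hQ s hs
    have h₂' := h₂.mono (Icc_subset_Icc_left hθ.1)
    exact eqOn_of_simple_roots hp hn isPreconnected_Icc h₁.1 h₂'.1 h₁.2 h₂'.2 h₁.3
      (right_mem_Icc.2 hθ.2) (h₁b.trans h₂b.symm) (left_mem_Icc.2 hθ.2)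
  have hmem : ∀ θ ∈ Ioc s₀ b, ∃ s ∈ T, s < θ := fun θ hθ => exists_lt_of_csInf_lt hne hθ.1
  have hpath : IsSimpleRootPath p (Ioc s₀ b) fun θ => Q θ θ := by
    refine ⟨fun θ hθ => ?_, fun θ hθ => ?_, fun θ hθ => ?_⟩
    all_goals
      obtain ⟨s, hs, hsθ⟩ := hmem θ hθ
      have hθs : θ ∈ Icc s b := ⟨hsθ.le, hθ.2⟩
    · refine (((hQ s hs).1.1.congr (heq s hs)) θ hθs).mono_of_mem_nhdsWithin ?_
      filter_upwards [self_mem_nhdsWithin, nhdsWithin_le_nhds (lt_mem_nhds hsθ)] with x h₁ h₂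
      exact ⟨h₂.le, h₁.2⟩
    · rw [show Q θ θ = Q s θ from heq s hs hθs]; exact (hQ s hs).1.2 θ hθs
    · rw [show Q θ θ = Q s θ from heq s hs hθs]; exact (hQ s hs).1.3 θ hθs
  obtain ⟨r, hr, hlim⟩ := exists_tendsto_root (contDiff_eval hp hn).continuous hs₀b (hp0 s₀)
    hpath.1 hpath.2 fun θ hθ => hB θ _ (hpath.2 θ hθ)
  -- The infimum itself need not lie in `T`, so the value there is prescribed as the limit.
  set q := Function.update (fun θ => Q θ θ) s₀ r with hq
  have hqe : ∀ θ, θ ≠ s₀ → q θ = Q θ θ := fun θ hθ => Function.update_of_ne hθ _ _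
  have hqs : q s₀ = r := Function.update_self _ _ _
  have hqpath : IsSimpleRootPath p (Ioc s₀ b) q := by
    refine ⟨hpath.1.congr fun θ hθ => hqe θ hθ.1.ne', fun θ hθ => ?_, fun θ hθ => ?_⟩
    · rw [hqe θ hθ.1.ne']; exact hpath.2 θ hθ
    · rw [hqe θ hθ.1.ne']; exact hpath.3 θ hθ
  have hqc : ContinuousOn q (Icc s₀ b) := by
    intro θ hθ
    rcases hθ.1.eq_or_lt with rfl | hlt
    · rw [hq, continuousWithinAt_update_same]
      exact hlim.mono_left (nhdsWithin_mono _ fun x hx => lt_of_le_of_ne hx.1.1 (Ne.symm hx.2))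
    · refine (hqpath.1 θ ⟨hlt, hθ.2⟩).mono_of_mem_nhdsWithin ?_
      filter_upwards [self_mem_nhdsWithin, nhdsWithin_le_nhds (lt_mem_nhds hlt)] with x h₁ h₂
      exact ⟨h₂, h₁.2⟩
  have hqb : q b = μ := by
    rw [hqe b hs₀b.ne']
    exact (hQ b (hTb.elim fun s hs => hup s hs.1 b hs.2.le le_rfl)).2
  refine ⟨s₀, ⟨has₀, hs₀b⟩, q, hqc, hqs ▸ hr, hqpath, hqb, ?_⟩
  -- A simple root at `s₀ > a` would extend further left, against the choice of the infimum.
  by_contra! hcon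
  have hpathc : IsSimpleRootPath p (Icc s₀ b) q := by
    refine ⟨hqc, fun θ hθ => ?_, fun θ hθ => ?_⟩
    all_goals rcases hθ.1.eq_or_lt with hlt | hlt
    · rw [← hlt, hqs]; exact hr
    · exact hqpath.2 θ ⟨hlt, hθ.2⟩
    · rw [← hlt]; exact hcon.2
    · exact hqpath.3 θ ⟨hlt, hθ.2⟩
  obtain ⟨s', hs', hlt⟩ := hext s₀ hs₀b.le (lt_of_le_of_ne has₀ hcon.1.symm) ⟨q, hpathc, hqb⟩
  exact (csInf_le hbdd hs').not_gt hlt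

end RootPaths

/-! ### Signs and ratio of the couplings -/

section Entries

variable {γ : ℝ}

theorem alpha_eq (γ : ℝ) : alpha γ = -(eta γ + beta γ) := by
  unfold alpha eta beta
  ring

theorem beta_neg (hγ : 0 < γ) : beta γ < 0 := by
  have : 1 < Real.exp γ := Real.one_lt_exp_iff.2 hγ
  exact div_neg_of_pos_of_neg hγ (by linarith)

theorem eta_eq (hγ : 0 < γ) : eta γ = Real.exp γ * beta γ := by
  have h1 : 1 < Real.exp γ := Real.one_lt_exp_iff.2 hγ
  have h2 : 1 - Real.exp γ ≠ 0 := by linarith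
  have h3 : Real.exp γ - 1 ≠ 0 := by linarith
  have h4 : 1 - Real.exp (-γ) = (Real.exp γ - 1) / Real.exp γ := by
    rw [Real.exp_neg]
    field_simp
  unfold eta beta
  rw [h4]
  field_simp
  ring

theorem eta_neg (hγ : 0 < γ) : eta γ < 0 := by
  rw [eta_eq hγ]
  exact mul_neg_of_pos_of_neg (Real.exp_pos _) (beta_neg hγ)

end Entries

/-! ### Symmetrising weights and zero row sums -/

section Gauge

variable {N : ℕ} {γ : ℝ}

theorem gauge_rev (N : ℕ) (γ : ℝ) (i j : Fin (2 * N)) :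
    gaugeCapacitanceMatrix N γ i.rev j.rev = gaugeCapacitanceMatrix N γ i j := by
  have hi := i.2
  have hj := j.2
  simp only [gaugeCapacitanceMatrix, Matrix.of_apply, Fin.val_rev]
  split_ifs <;> first | rfl | omega

/-- The weights that make the gauge capacitance matrix symmetric. -/
noncomputable def gaugeWeight (N : ℕ) (γ : ℝ) (i : Fin (2 * N)) : ℝ :=
  Real.exp γ ^ min (i : ℕ) (2 * N - 1 - i)

theorem gaugeWeight_pos (i : Fin (2 * N)) : 0 < gaugeWeight N γ i :=
  pow_pos (Real.exp_pos _) _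

theorem gaugeWeight_rev (i : Fin (2 * N)) : gaugeWeight N γ i.rev = gaugeWeight N γ i := by
  have hi := i.2
  unfold gaugeWeight
  congr 1
  simp only [Fin.val_rev]
  omega

theorem gauge_succ {i j : Fin (2 * N)} (h : (j : ℕ) = i + 1) :
    gaugeCapacitanceMatrix N γ i j = if (i : ℕ) < N then eta γ else beta γ := by
  rw [gaugeCapacitanceMatrix, Matrix.of_apply, if_neg (by omega), if_pos h]

theorem gauge_pred {i j : Fin (2 * N)} (h : (j : ℕ) = i + 1) :
    gaugeCapacitanceMatrix N γ j i = if (j : ℕ) < N then beta γ else eta γ := by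
  rw [gaugeCapacitanceMatrix, Matrix.of_apply, if_neg (by omega), if_neg (by omega), if_pos h]

/-- Detailed balance. The ratio of forward to backward coupling is `e^γ` in the first half and
`e^{-γ}` in the second, while across the middle bond both couplings are `η`. The weights thus grow
geometrically towards the middle and take equal values at the two central sites. -/
theorem gaugeWeight_mul_succ (hγ : 0 < γ) {i j : Fin (2 * N)} (hij : (j : ℕ) = i + 1) :
    gaugeWeight N γ i * gaugeCapacitanceMatrix N γ i j =
      gaugeWeight N γ j * gaugeCapacitanceMatrix N γ j i := by
  have hj := j.2
  rw [gauge_succ hij, gauge_pred hij, gaugeWeight, gaugeWeight, hij]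
  rcases lt_trichotomy ((i : ℕ) + 1) N with h | h | h
  · rw [if_pos (by omega), if_pos h,
      show min ((i : ℕ) + 1) (2 * N - 1 - (i + 1)) = i + 1 by omega,
      show min (i : ℕ) (2 * N - 1 - i) = i by omega, eta_eq hγ]
    ring
  · rw [if_pos (by omega), if_neg (by omega),
      show min ((i : ℕ) + 1) (2 * N - 1 - (i + 1)) = i by omega,
      show min (i : ℕ) (2 * N - 1 - i) = i by omega]
  · obtain ⟨k, hk⟩ : ∃ k, 2 * N = i + 2 + k := ⟨2 * N - (i + 2), by omega⟩
    rw [if_neg (by omega), if_neg (by omega),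
      show min ((i : ℕ) + 1) (2 * N - 1 - (i + 1)) = k by omega,
      show min (i : ℕ) (2 * N - 1 - i) = k + 1 by omega, eta_eq hγ]
    ring

theorem gauge_eq_zero {i j : Fin (2 * N)} (h : (i : ℕ) ≠ j) (h1 : (j : ℕ) ≠ i + 1)
    (h2 : (i : ℕ) ≠ j + 1) : gaugeCapacitanceMatrix N γ i j = 0 := by
  simp only [gaugeCapacitanceMatrix, Matrix.of_apply, h, h1, h2, if_false]

theorem gaugeWeight_mul_comm (hγ : 0 < γ) (i j : Fin (2 * N)) :
    gaugeWeight N γ i * gaugeCapacitanceMatrix N γ i j =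
      gaugeWeight N γ j * gaugeCapacitanceMatrix N γ j i := by
  by_cases h : (i : ℕ) = j
  · rw [Fin.ext h]
  by_cases h1 : (j : ℕ) = i + 1
  · exact gaugeWeight_mul_succ hγ h1
  by_cases h2 : (i : ℕ) = j + 1
  · exact (gaugeWeight_mul_succ hγ h2).symm
  rw [gauge_eq_zero h h1 h2, gauge_eq_zero (Ne.symm h) h2 h1, mul_zero, mul_zero]

theorem gauge_nonpos (hγ : 0 < γ) {i j : Fin (2 * N)} (h : i ≠ j) :
    gaugeCapacitanceMatrix N γ i j ≤ 0 := by
  have hb := (beta_neg hγ).le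
  have he := (eta_neg hγ).le
  have h' : (i : ℕ) ≠ j := fun h' => h (Fin.ext h')
  simp only [gaugeCapacitanceMatrix, Matrix.of_apply, h', if_false]
  split_ifs <;> first | assumption | exact le_rfl

theorem gauge_succ_neg (hγ : 0 < γ) {i j : Fin (2 * N)} (h : (j : ℕ) = i + 1) :
    gaugeCapacitanceMatrix N γ i j < 0 := by
  have hb := beta_neg hγ
  have he := eta_neg hγ
  rw [gauge_succ h]
  split_ifs <;> assumption

/-- In an interior row `α = -(η + β)` balances the two neighbours. In either corner row the missing
coupling is `β`, which the corner entry `α + β` absorbs. -/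
theorem gauge_row_sum (i : Fin (2 * N)) : ∑ j, gaugeCapacitanceMatrix N γ i j = 0 := by
  have hi := i.2
  have key : ∀ j : Fin (2 * N), gaugeCapacitanceMatrix N γ i j =
      (if i = j then
        if (i : ℕ) = 0 ∨ (i : ℕ) + 1 = 2 * N then alpha γ + beta γ else alpha γ else 0) +
      (if h : (i : ℕ) + 1 < 2 * N then
        if (⟨i + 1, h⟩ : Fin (2 * N)) = j then (if (i : ℕ) < N then eta γ else beta γ) else 0
        else 0) +
      (if h : 1 ≤ (i : ℕ) then
        if (⟨i - 1, by omega⟩ : Fin (2 * N)) = j then (if (i : ℕ) < N then beta γ else eta γ)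
          else 0
        else 0) := by
    intro j
    have hj := j.2
    simp only [gaugeCapacitanceMatrix, Matrix.of_apply, Fin.ext_iff]
    split_ifs <;> first | omega | simp
  simp only [key, Finset.sum_add_distrib]
  rw [Finset.sum_ite_eq]
  have e2 : ∑ j, (if h : (i : ℕ) + 1 < 2 * N then
        if (⟨i + 1, h⟩ : Fin (2 * N)) = j then (if (i : ℕ) < N then eta γ else beta γ) else 0
        else 0) = if (i : ℕ) + 1 < 2 * N then (if (i : ℕ) < N then eta γ else beta γ) else 0 := by
    by_cases h : (i : ℕ) + 1 < 2 * N
    · simp [h]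
    · simp [h]
  have e3 : ∑ j, (if h : 1 ≤ (i : ℕ) then
        if (⟨i - 1, by omega⟩ : Fin (2 * N)) = j then (if (i : ℕ) < N then beta γ else eta γ)
          else 0
        else 0) = if 1 ≤ (i : ℕ) then (if (i : ℕ) < N then beta γ else eta γ) else 0 := by
    by_cases h : 1 ≤ (i : ℕ)
    · simp [h]
    · simp [h]
  rw [e2, e3, alpha_eq]
  simp only [Finset.mem_univ, if_true]
  split_ifs <;> first | omega | ring

end Gauge

/-! ### Multiplicities, conjugation symmetry and dependence on `θ` -/

section Tridiagonal

variable {N : ℕ} {γ θ : ℝ}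

/-- The diagonal entries of the material matrix. -/
noncomputable def materialPhase (N : ℕ) (θ : ℝ) (i : Fin (2 * N)) : ℂ :=
  if (i : ℕ) < N then Complex.exp (Complex.I * θ) else Complex.exp (-(Complex.I * θ))

/-- The gauge capacitance matrix with complex entries. -/
noncomputable abbrev gaugeC (N : ℕ) (γ : ℝ) : Matrix (Fin (2 * N)) (Fin (2 * N)) ℂ :=
  (gaugeCapacitanceMatrix N γ).map (fun x : ℝ => (x : ℂ))

theorem genCapacitanceMatrix_mulVec (x : Fin (2 * N) → ℂ) (i : Fin (2 * N)) :
    (genCapacitanceMatrix N θ γ).mulVec x i =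
      materialPhase N θ i * (gaugeC N γ).mulVec x i := by
  rw [genCapacitanceMatrix, ← Matrix.mulVec_mulVec, materialMatrix, Matrix.mulVec_diagonal]
  rfl

theorem materialPhase_ne_zero (i : Fin (2 * N)) : materialPhase N θ i ≠ 0 := by
  unfold materialPhase
  split_ifs <;> exact Complex.exp_ne_zero _

theorem conj_materialPhase (i : Fin (2 * N)) :
    (starRingEnd ℂ) (materialPhase N θ i) = (materialPhase N θ i)⁻¹ := by
  unfold materialPhase
  split_ifs <;> simp [← Complex.exp_conj, ← Complex.exp_neg]

theorem materialPhase_rev (i : Fin (2 * N)) :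
    materialPhase N θ i.rev = (materialPhase N θ i)⁻¹ := by
  have := i.2
  unfold materialPhase
  rw [Fin.val_rev]
  split_ifs <;> first | omega | simp [← Complex.exp_neg]

theorem norm_materialPhase (i : Fin (2 * N)) : ‖materialPhase N θ i‖ = 1 := by
  unfold materialPhase
  split_ifs
  · rw [mul_comm, Complex.norm_exp_ofReal_mul_I]
  · rw [show -(Complex.I * θ) = ((-θ : ℝ) : ℂ) * Complex.I by push_cast; ring,
      Complex.norm_exp_ofReal_mul_I]

theorem re_inv_materialPhase (i : Fin (2 * N)) : ((materialPhase N θ i)⁻¹).re = Real.cos θ := by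
  unfold materialPhase
  split_ifs <;> simp [← Complex.exp_neg, Complex.exp_re]

theorem materialPhase_zero (i : Fin (2 * N)) : materialPhase N 0 i = 1 := by
  simp [materialPhase]

theorem inv_materialPhase_pi_div_two (i : Fin (2 * N)) :
    (materialPhase N (Real.pi / 2) i)⁻¹ = -materialPhase N (Real.pi / 2) i := by
  have h : Complex.I * ((Real.pi / 2 : ℝ) : ℂ) = Real.pi / 2 * Complex.I := by
    push_cast; ring
  unfold materialPhase
  split_ifs
  · rw [h, Complex.exp_pi_div_two_mul_I]; simp
  · rw [Complex.exp_neg, h, Complex.exp_pi_div_two_mul_I]; simp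

/-- An eigenvector is determined by its first entry. -/
theorem eigenvector_eq_zero (hγ : 0 < γ) {μ : ℂ} {x : Fin (2 * N) → ℂ}
    (hx : (genCapacitanceMatrix N θ γ).mulVec x = μ • x) (h0 : ∀ i : Fin (2 * N), (i : ℕ) = 0 → x i = 0) :
    x = 0 := by
  have key : ∀ m : ℕ, ∀ i : Fin (2 * N), (i : ℕ) ≤ m → x i = 0 := by
    intro m
    induction m with
    | zero => exact fun i hi => h0 i (by omega)
    | succ m ih =>
      intro i hi
      rcases hi.lt_or_eq with hlt | heq
      · exact ih i (by omega)
      -- Once the entries up to `m` vanish, row `m` of the eigenvalue equation retains only the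
      -- superdiagonal term, whose coefficient is nonzero.
      let k : Fin (2 * N) := ⟨m, by omega⟩
      have h1 := congrFun hx k
      rw [genCapacitanceMatrix_mulVec, Pi.smul_apply, ih k le_rfl, smul_zero,
        mul_eq_zero, or_iff_right (materialPhase_ne_zero k), Matrix.mulVec, dotProduct,
        Finset.sum_eq_single i] at h1
      · have h2 := (gauge_succ_neg (N := N) hγ (i := k) (j := i) heq).ne
        simpa [h2] using h1
      · intro j _ hji
        have hji' : (j : ℕ) ≠ m + 1 := fun h => hji (Fin.ext (h.trans heq.symm))
        by_cases hjm : (j : ℕ) ≤ m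
        · rw [ih j hjm, mul_zero]
        · have : gaugeCapacitanceMatrix N γ k j = 0 :=
            gauge_eq_zero (show m ≠ j by omega) (show (j : ℕ) ≠ m + 1 from hji')
              (show m ≠ j + 1 by omega)
          simp [this]
      · simp
  exact funext fun i => key i i le_rfl

theorem finrank_eigenspace_le_one (hN : 1 ≤ N) (hγ : 0 < γ) (μ : ℂ) :
    Module.finrank ℂ (Module.End.eigenspace (Matrix.toLin' (genCapacitanceMatrix N θ γ)) μ)
      ≤ 1 := by
  let e : (Module.End.eigenspace (Matrix.toLin' (genCapacitanceMatrix N θ γ)) μ) →ₗ[ℂ] ℂ :=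
    (LinearMap.proj (⟨0, by omega⟩ : Fin (2 * N))).comp (Submodule.subtype _)
  have he : Function.Injective e := by
    rw [injective_iff_map_eq_zero]
    rintro ⟨x, hx⟩ hx0
    rw [Module.End.mem_eigenspace_iff, Matrix.toLin'_apply] at hx
    refine Subtype.ext (eigenvector_eq_zero hγ hx fun i hi => ?_)
    have hi' : i = ⟨0, by omega⟩ := Fin.ext hi
    rw [hi']
    exact hx0
  simpa using LinearMap.finrank_le_finrank_of_injective he

theorem algMultiplicity_eq_finrank (N : ℕ) (γ θ : ℝ) (μ : ℂ) :
    algMultiplicity N γ θ μ = Module.finrank ℂ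
      (Module.End.maxGenEigenspace (Matrix.toLin' (genCapacitanceMatrix N θ γ)) μ) := by
  rw [LinearMap.finrank_maxGenEigenspace_eq, Matrix.charpoly_toLin', algMultiplicity]

theorem hasEigenvalue_iff_isRoot (N : ℕ) (γ θ : ℝ) (μ : ℂ) :
    Module.End.HasEigenvalue (Matrix.toLin' (genCapacitanceMatrix N θ γ)) μ ↔
      (genCapacitanceMatrix N θ γ).charpoly.eval μ = 0 := by
  rw [Module.End.hasEigenvalue_iff_isRoot_charpoly, Matrix.charpoly_toLin', IsRoot.def]

theorem eigenspace_le_maxGenEigenspace {V : Type*} [AddCommGroup V] [Module ℂ V]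
    (f : Module.End ℂ V) (μ : ℂ) : f.eigenspace μ ≤ f.maxGenEigenspace μ :=
  (f.genEigenspace μ).monotone le_top

/-- An eigenvalue of a matrix in the family is defective exactly when it is a multiple root of the
characteristic polynomial. -/
theorem isDefectiveEigenvalue_iff (hN : 1 ≤ N) (hγ : 0 < γ) {μ : ℂ}
    (hμ : (genCapacitanceMatrix N θ γ).charpoly.eval μ = 0) :
    IsDefectiveEigenvalue (genCapacitanceMatrix N θ γ) μ ↔
      (derivative (genCapacitanceMatrix N θ γ).charpoly).eval μ = 0 := by
  have h1 := one_lt_rootMultiplicity_iff_isRoot (t := μ)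
    (Matrix.charpoly_monic (genCapacitanceMatrix N θ γ)).ne_zero
  simp only [IsRoot.def, hμ, true_and] at h1
  rw [← h1, ← algMultiplicity, algMultiplicity_eq_finrank]
  have hle := finrank_eigenspace_le_one (θ := θ) hN hγ μ
  constructor
  · intro h
    have := Submodule.finrank_lt_finrank_of_lt h
    have hpos : 0 < Module.finrank ℂ
        (Module.End.eigenspace (Matrix.toLin' (genCapacitanceMatrix N θ γ)) μ) := by
      rw [Module.finrank_pos_iff, Submodule.nontrivial_iff_ne_bot]
      exact (hasEigenvalue_iff_isRoot N γ θ μ).2 hμ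
    omega
  · intro h
    refine lt_of_le_of_ne (eigenspace_le_maxGenEigenspace _ μ) fun heq => ?_
    rw [heq] at hle
    omega

theorem rootMultiplicity_eq_one_iff {p : ℂ[X]} (h0 : p ≠ 0) {μ : ℂ} :
    p.rootMultiplicity μ = 1 ↔ p.eval μ = 0 ∧ (derivative p).eval μ ≠ 0 := by
  have h1 := one_lt_rootMultiplicity_iff_isRoot (t := μ) h0
  have h2 := rootMultiplicity_pos (x := μ) h0
  rw [IsRoot.def] at h2
  simp only [IsRoot.def] at h1
  rw [← h2]
  constructor
  · intro h
    exact ⟨by omega, fun h' => by have := h1.2 ⟨h2.1 (by omega), h'⟩; omega⟩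
  · rintro ⟨h3, h4⟩
    by_contra hne
    exact h4 (h1.1 (by omega)).2

theorem algMultiplicity_eq_one_iff {μ : ℂ} :
    algMultiplicity N γ θ μ = 1 ↔ (genCapacitanceMatrix N θ γ).charpoly.eval μ = 0 ∧
      (derivative (genCapacitanceMatrix N θ γ).charpoly).eval μ ≠ 0 :=
  rootMultiplicity_eq_one_iff (Matrix.charpoly_monic _).ne_zero

/-- An eigenvalue without generalised eigenvectors of rank two is simple. -/
theorem algMultiplicity_eq_one (hN : 1 ≤ N) (hγ : 0 < γ) {μ : ℂ}
    (hμ : (genCapacitanceMatrix N θ γ).charpoly.eval μ = 0)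
    (h : ∀ x u : Fin (2 * N) → ℂ, (genCapacitanceMatrix N θ γ).mulVec x = μ • x + u →
      (genCapacitanceMatrix N θ γ).mulVec u = μ • u → u = 0) :
    algMultiplicity N γ θ μ = 1 := by
  refine algMultiplicity_eq_one_iff.2 ⟨hμ, fun h' => ?_⟩
  have hd := (isDefectiveEigenvalue_iff hN hγ hμ).2 h'
  refine hd.not_ge fun x hx => ?_
  obtain ⟨k, hk⟩ := (Module.End.mem_maxGenEigenspace _ _ _).1 hx
  set f := Matrix.toLin' (genCapacitanceMatrix N θ γ) - μ • (1 : Module.End ℂ (Fin (2 * N) → ℂ))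
    with hf
  have hfa : ∀ y, (genCapacitanceMatrix N θ γ).mulVec y = μ • y + f y := fun y => by
    simp [hf]
  -- Kernels of powers that agree once are constant from there on, so excluding chains of length two
  -- excludes all longer ones.
  have hker : LinearMap.ker (f ^ 1) = LinearMap.ker (f ^ (1 + 1)) := by
    refine le_antisymm (fun y hy => ?_) fun y hy => ?_
    · rw [LinearMap.mem_ker] at hy ⊢
      rw [pow_succ', Module.End.mul_apply, hy, map_zero]
    · rw [LinearMap.mem_ker, pow_one]
      refine h y (f y) (hfa y) ?_
      rw [hfa (f y)]
      have : f (f y) = 0 := by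
        rw [LinearMap.mem_ker, pow_add, pow_one] at hy
        exact hy
      rw [this, add_zero]
  have hx1 : x ∈ LinearMap.ker (f ^ (1 + k)) := by
    rw [LinearMap.mem_ker, pow_add, Module.End.mul_apply, hk, map_zero]
  rw [← Module.End.ker_pow_constant hker k, LinearMap.mem_ker, pow_one] at hx1
  rw [Module.End.mem_eigenspace_iff, Matrix.toLin'_apply, hfa, hx1, add_zero]

/-- The family is symmetric under reversal combined with complex conjugation. -/
theorem charpoly_eval_conj {μ : ℂ} (hμ : (genCapacitanceMatrix N θ γ).charpoly.eval μ = 0) :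
    (genCapacitanceMatrix N θ γ).charpoly.eval ((starRingEnd ℂ) μ) = 0 := by
  rw [← hasEigenvalue_iff_isRoot] at hμ ⊢
  obtain ⟨x, hx, hx0⟩ := hμ.exists_hasEigenvector
  rw [Module.End.mem_eigenspace_iff, Matrix.toLin'_apply] at hx
  refine Module.End.hasEigenvalue_of_hasEigenvector
    (x := fun i => (starRingEnd ℂ) (x i.rev)) ⟨?_, fun h => hx0 ?_⟩
  · rw [Module.End.mem_eigenspace_iff, Matrix.toLin'_apply]
    ext i
    have h1 := congrArg (starRingEnd ℂ) (congrFun hx i.rev)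
    rw [genCapacitanceMatrix_mulVec, map_mul, conj_materialPhase, materialPhase_rev, inv_inv,
      Pi.smul_apply, smul_eq_mul, map_mul] at h1
    rw [genCapacitanceMatrix_mulVec, Pi.smul_apply, smul_eq_mul, ← h1]
    congr 1
    simp only [Matrix.mulVec, dotProduct, map_sum, map_mul, Matrix.map_apply, Complex.conj_ofReal]
    refine Fintype.sum_equiv Fin.revPerm _ _ fun j => ?_
    rw [Fin.revPerm_apply, gauge_rev]
  · ext i
    simpa using congrFun h i.rev

/-- The eigenvalues are bounded uniformly in `θ`. -/
theorem norm_eigenvalue_le {μ : ℂ} (hμ : (genCapacitanceMatrix N θ γ).charpoly.eval μ = 0) :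
    ‖μ‖ ≤ ∑ i, ∑ j, |gaugeCapacitanceMatrix N γ i j| := by
  rw [← hasEigenvalue_iff_isRoot] at hμ
  obtain ⟨x, hx, hx0⟩ := hμ.exists_hasEigenvector
  rw [Module.End.mem_eigenspace_iff, Matrix.toLin'_apply] at hx
  obtain ⟨k, hk⟩ := Function.ne_iff.1 hx0
  -- At an entry of largest modulus the row gives a Gershgorin-type bound; the phases have modulus
  -- one, hence no dependence on `θ`.
  obtain ⟨i, -, hi⟩ := Finset.exists_max_image Finset.univ (fun i => ‖x i‖)
    ⟨k, Finset.mem_univ k⟩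
  have hpos : 0 < ‖x i‖ := (norm_pos_iff.2 hk).trans_le (hi k (Finset.mem_univ k))
  have h1 : ‖μ‖ * ‖x i‖ ≤ (∑ j, |gaugeCapacitanceMatrix N γ i j|) * ‖x i‖ := by
    have h2 := congrArg norm (congrFun hx i)
    rw [genCapacitanceMatrix_mulVec, norm_mul, norm_materialPhase, one_mul, Pi.smul_apply,
      norm_smul] at h2
    rw [← h2, Finset.sum_mul]
    refine (norm_sum_le Finset.univ fun j => gaugeC N γ i j * x j).trans
      (Finset.sum_le_sum fun j _ => ?_)
    have h3 : ‖gaugeC N γ i j‖ = |gaugeCapacitanceMatrix N γ i j| := Complex.norm_real _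
    rw [norm_mul, h3]
    exact mul_le_mul_of_nonneg_left (hi j (Finset.mem_univ j)) (abs_nonneg _)
  refine (le_of_mul_le_mul_right h1 hpos).trans ?_
  exact Finset.single_le_sum (f := fun i => ∑ j, |gaugeCapacitanceMatrix N γ i j|)
    (fun i _ => Finset.sum_nonneg fun j _ => abs_nonneg _) (Finset.mem_univ i)

theorem contDiff_eval_mvPolynomial {σ E : Type*} [NormedAddCommGroup E]
    [NormedSpace ℝ E] (P : MvPolynomial σ ℂ) {g : E → σ → ℂ}
    (hg : ∀ s, ContDiff ℝ 1 fun e => g e s) : ContDiff ℝ 1 fun e => MvPolynomial.eval (g e) P := by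
  induction P using MvPolynomial.induction_on with
  | C a => simpa using contDiff_const
  | add P Q hP hQ => simpa using hP.add hQ
  | mul_X P s hP => simpa using hP.mul (hg s)

/-- The coefficients are universal polynomials in the matrix entries, and these are exponentials in
`θ` times constants. -/
theorem contDiff_charpoly_coeff (N : ℕ) (γ : ℝ) (k : ℕ) :
    ContDiff ℝ 1 fun θ => (genCapacitanceMatrix N θ γ).charpoly.coeff k := by
  have h : ∀ θ, (genCapacitanceMatrix N θ γ).charpoly.coeff k =
      MvPolynomial.eval (fun s : Fin (2 * N) × Fin (2 * N) => genCapacitanceMatrix N θ γ s.1 s.2)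
        ((Matrix.charpoly.univ ℂ (Fin (2 * N))).coeff k) := fun θ => by
    exact (Matrix.charpoly.univ_coeff_eval₂Hom (Fin (2 * N)) (RingHom.id ℂ)
      (fun s => genCapacitanceMatrix N θ γ s.1 s.2) k).symm
  simp only [h]
  refine contDiff_eval_mvPolynomial _ fun s => ?_
  simp only [genCapacitanceMatrix, materialMatrix, Matrix.diagonal_mul]
  refine ContDiff.mul ?_ contDiff_const
  have : ContDiff ℝ 1 fun θ : ℝ => Complex.I * (θ : ℂ) :=
    contDiff_const.mul Complex.ofRealCLM.contDiff
  split_ifs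
  · exact this.cexp
  · exact this.neg.cexp

theorem natDegree_charpoly (N : ℕ) (γ θ : ℝ) :
    (genCapacitanceMatrix N θ γ).charpoly.natDegree = 2 * N := by
  rw [Matrix.charpoly_natDegree_eq_dim, Fintype.card_fin]

end Tridiagonal

/-! ### The Dirichlet form and the spectra at `θ = 0` and `θ = π/2` -/

section WeightedForm

variable {N : ℕ} {γ θ : ℝ}

/-- The weighted inner product for which the gauge capacitance matrix is self-adjoint. -/
noncomputable def weightedInner (N : ℕ) (γ : ℝ) (x y : Fin (2 * N) → ℂ) : ℂ :=
  ∑ i, (gaugeWeight N γ i : ℂ) * ((starRingEnd ℂ) (x i) * y i)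

theorem weightedInner_add_right (x y z : Fin (2 * N) → ℂ) :
    weightedInner N γ x (y + z) = weightedInner N γ x y + weightedInner N γ x z := by
  simp only [weightedInner, ← Finset.sum_add_distrib, Pi.add_apply]
  exact Finset.sum_congr rfl fun i _ => by ring

theorem weightedInner_smul_right (c : ℂ) (x y : Fin (2 * N) → ℂ) :
    weightedInner N γ x (c • y) = c * weightedInner N γ x y := by
  simp only [weightedInner, Finset.mul_sum, Pi.smul_apply, smul_eq_mul]
  exact Finset.sum_congr rfl fun i _ => by ring

theorem weightedInner_smul_left (c : ℂ) (x y : Fin (2 * N) → ℂ) :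
    weightedInner N γ (c • x) y = (starRingEnd ℂ) c * weightedInner N γ x y := by
  simp only [weightedInner, Finset.mul_sum, Pi.smul_apply, smul_eq_mul, map_mul]
  exact Finset.sum_congr rfl fun i _ => by ring

theorem weightedInner_self_eq_zero {x : Fin (2 * N) → ℂ} (h : weightedInner N γ x x = 0) :
    x = 0 := by
  have h1 : weightedInner N γ x x = ((∑ i, gaugeWeight N γ i * Complex.normSq (x i) : ℝ) : ℂ) := by
    rw [weightedInner, Complex.ofReal_sum]
    refine Finset.sum_congr rfl fun i _ => ?_
    rw [Complex.ofReal_mul, Complex.normSq_eq_conj_mul_self]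
  rw [h1, Complex.ofReal_eq_zero, Finset.sum_eq_zero_iff_of_nonneg fun i _ =>
    mul_nonneg (gaugeWeight_pos i).le (Complex.normSq_nonneg _)] at h
  ext i
  simpa [(gaugeWeight_pos i).ne'] using h i (Finset.mem_univ i)

theorem weightedInner_mulVec (hγ : 0 < γ) (x y : Fin (2 * N) → ℂ) :
    weightedInner N γ x ((gaugeC N γ).mulVec y) = weightedInner N γ ((gaugeC N γ).mulVec x) y := by
  simp only [weightedInner, Matrix.mulVec, dotProduct, map_sum, map_mul, Finset.mul_sum,
    Finset.sum_mul, Matrix.map_apply, Complex.conj_ofReal]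
  rw [Finset.sum_comm]
  refine Finset.sum_congr rfl fun i _ => Finset.sum_congr rfl fun j _ => ?_
  have h : (gaugeWeight N γ i : ℂ) * gaugeCapacitanceMatrix N γ i j =
      gaugeWeight N γ j * gaugeCapacitanceMatrix N γ j i := by
    exact_mod_cast gaugeWeight_mul_comm hγ i j
  linear_combination (-(starRingEnd ℂ) (x j) * y i) * h

theorem gaugeC_mulVec_const (c : ℂ) : (gaugeC N γ).mulVec (fun _ => c) = 0 := by
  ext i
  simp only [Matrix.mulVec, dotProduct, Matrix.map_apply, Pi.zero_apply]
  rw [← Finset.sum_mul, ← Complex.ofReal_sum, gauge_row_sum, Complex.ofReal_zero, zero_mul]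

/-- The Dirichlet form of the gauge capacitance matrix. -/
theorem weightedInner_mulVec_self (hγ : 0 < γ) (x : Fin (2 * N) → ℂ) :
    2 * weightedInner N γ x ((gaugeC N γ).mulVec x) =
      ((∑ i, ∑ j, -(gaugeWeight N γ i * gaugeCapacitanceMatrix N γ i j) *
        Complex.normSq (x i - x j) : ℝ) : ℂ) := by
  set K : Fin (2 * N) → Fin (2 * N) → ℂ := fun i j =>
    (gaugeWeight N γ i : ℂ) * gaugeCapacitanceMatrix N γ i j with hK
  have hsymm : ∀ i j, K i j = K j i := fun i j => by
    simp only [hK]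
    exact_mod_cast gaugeWeight_mul_comm hγ i j
  have hrow : ∀ i, ∑ j, K i j = 0 := fun i => by
    simp only [hK]
    rw [← Finset.mul_sum, ← Complex.ofReal_sum, gauge_row_sum, Complex.ofReal_zero, mul_zero]
  have hcol : ∀ j, ∑ i, K i j = 0 := fun j => by simpa only [hsymm _ j] using hrow j
  have h1 : ∑ i, ∑ j, K i j * ((starRingEnd ℂ) (x i) * x i) = 0 := by
    simp only [← Finset.sum_mul, hrow, zero_mul, Finset.sum_const_zero]
  have h2 : ∑ i, ∑ j, K i j * ((starRingEnd ℂ) (x j) * x j) = 0 := by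
    rw [Finset.sum_comm]
    simp only [← Finset.sum_mul, hcol, zero_mul, Finset.sum_const_zero]
  have h3 : ∑ i, ∑ j, K i j * ((starRingEnd ℂ) (x i) * x j) =
      weightedInner N γ x ((gaugeC N γ).mulVec x) := by
    simp only [weightedInner, Matrix.mulVec, dotProduct, Finset.mul_sum, Matrix.map_apply, hK]
    exact Finset.sum_congr rfl fun i _ => Finset.sum_congr rfl fun j _ => by ring
  have h4 : ∑ i, ∑ j, K i j * ((starRingEnd ℂ) (x j) * x i) =
      weightedInner N γ x ((gaugeC N γ).mulVec x) := by
    rw [← h3, Finset.sum_comm]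
    simp only [hsymm]
  have h5 : ((∑ i, ∑ j, -(gaugeWeight N γ i * gaugeCapacitanceMatrix N γ i j) *
        Complex.normSq (x i - x j) : ℝ) : ℂ) =
      ∑ i, ∑ j, (K i j * ((starRingEnd ℂ) (x i) * x j) + K i j * ((starRingEnd ℂ) (x j) * x i)
        - K i j * ((starRingEnd ℂ) (x i) * x i) - K i j * ((starRingEnd ℂ) (x j) * x j)) := by
    push_cast
    refine Finset.sum_congr rfl fun i _ => Finset.sum_congr rfl fun j _ => ?_
    rw [Complex.normSq_eq_conj_mul_self, map_sub]
    simp only [hK]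
    ring
  rw [h5]
  simp only [Finset.sum_add_distrib, Finset.sum_sub_distrib]
  rw [h1, h2, h3, h4]
  ring

/-- The Dirichlet form vanishes only on constant vectors. -/
theorem eq_const_of_weightedInner_eq_zero (hγ : 0 < γ) {x : Fin (2 * N) → ℂ}
    (h : weightedInner N γ x ((gaugeC N γ).mulVec x) = 0) : ∃ c, x = fun _ => c := by
  have h1 := weightedInner_mulVec_self hγ x
  rw [h, mul_zero, eq_comm, Complex.ofReal_eq_zero] at h1
  have hnn : ∀ i j : Fin (2 * N), 0 ≤ -(gaugeWeight N γ i * gaugeCapacitanceMatrix N γ i j) *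
      Complex.normSq (x i - x j) := fun i j => by
    by_cases hij : i = j
    · simp [hij]
    · exact mul_nonneg (neg_nonneg.2 (mul_nonpos_of_nonneg_of_nonpos (gaugeWeight_pos i).le
        (gauge_nonpos hγ hij))) (Complex.normSq_nonneg _)
  rw [Finset.sum_eq_zero_iff_of_nonneg fun i _ => Finset.sum_nonneg fun j _ => hnn i j] at h1
  have hstep : ∀ i j : Fin (2 * N), (j : ℕ) = i + 1 → x i = x j := fun i j hij => by
    have h2 := h1 i (Finset.mem_univ i)
    rw [Finset.sum_eq_zero_iff_of_nonneg fun j _ => hnn i j] at h2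
    have h3 := h2 j (Finset.mem_univ j)
    have h4 := (gauge_succ_neg (γ := γ) hγ hij).ne
    have h5 := (gaugeWeight_pos (γ := γ) i).ne'
    simpa [h4, h5, sub_eq_zero] using h3
  rcases Nat.eq_zero_or_pos (2 * N) with h0 | hpos
  · exact ⟨0, funext fun i => by have := i.2; omega⟩
  refine ⟨x ⟨0, hpos⟩, funext fun i => ?_⟩
  obtain ⟨m, hm⟩ := i
  induction m with
  | zero => rfl
  | succ m ih => rw [← hstep ⟨m, by omega⟩ ⟨m + 1, hm⟩ rfl, ih]

theorem mulVec_eq_zero_of_weightedInner_eq_zero (hγ : 0 < γ) {x : Fin (2 * N) → ℂ}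
    (h : weightedInner N γ x ((gaugeC N γ).mulVec x) = 0) : (gaugeC N γ).mulVec x = 0 := by
  obtain ⟨c, rfl⟩ := eq_const_of_weightedInner_eq_zero hγ h
  exact gaugeC_mulVec_const c

theorem eq_const_of_mulVec_eq_zero (hγ : 0 < γ) {x : Fin (2 * N) → ℂ}
    (h : (gaugeC N γ).mulVec x = 0) : ∃ c, x = fun _ => c :=
  eq_const_of_weightedInner_eq_zero hγ (by simp [h, weightedInner])

theorem genCapacitanceMatrix_mulVec_eq_zero_iff {x : Fin (2 * N) → ℂ} :
    (genCapacitanceMatrix N θ γ).mulVec x = 0 ↔ (gaugeC N γ).mulVec x = 0 := by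
  simp only [funext_iff, genCapacitanceMatrix_mulVec, Pi.zero_apply, mul_eq_zero,
    materialPhase_ne_zero, false_or]

theorem gaugeWeight_sum_pos (hN : 1 ≤ N) : 0 < ∑ i, gaugeWeight N γ i :=
  Finset.sum_pos (fun i _ => gaugeWeight_pos i) ⟨⟨0, by omega⟩, Finset.mem_univ _⟩

/-- By self-adjointness the range of `C` is orthogonal to its kernel, the constants. This is the
solvability condition for `C x = y`. -/
theorem sum_gaugeWeight_mul_mulVec (hγ : 0 < γ) (x : Fin (2 * N) → ℂ) :
    ∑ i, (gaugeWeight N γ i : ℂ) * (gaugeC N γ).mulVec x i = 0 := by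
  have h := weightedInner_mulVec hγ (fun _ => 1) x
  rw [gaugeC_mulVec_const] at h
  simpa [weightedInner] using h

theorem isRoot_zero (hN : 1 ≤ N) : (genCapacitanceMatrix N θ γ).charpoly.eval 0 = 0 := by
  rw [← hasEigenvalue_iff_isRoot]
  refine Module.End.hasEigenvalue_of_hasEigenvector (x := fun _ => 1) ⟨?_, fun h => ?_⟩
  · rw [Module.End.mem_eigenspace_iff, Matrix.toLin'_apply, zero_smul,
      genCapacitanceMatrix_mulVec_eq_zero_iff, gaugeC_mulVec_const]
  · simpa using congrFun h ⟨0, by omega⟩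

/-- A Jordan chain at `0` would solve `C x = c V⁻¹ 1`. Solvability makes `c` times the weighted sum
of inverse phases zero, and that sum has real part `cos θ` times the total weight. -/
theorem algMultiplicity_zero_of_cos_pos (hN : 1 ≤ N) (hγ : 0 < γ) (hθ : 0 < Real.cos θ) :
    algMultiplicity N γ θ 0 = 1 := by
  refine algMultiplicity_eq_one hN hγ (isRoot_zero hN) fun x u hx hu => ?_
  rw [zero_smul, zero_add] at hx
  rw [zero_smul, genCapacitanceMatrix_mulVec_eq_zero_iff] at hu
  obtain ⟨c, rfl⟩ := eq_const_of_mulVec_eq_zero hγ hu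
  have h1 : ∀ i, (gaugeC N γ).mulVec x i = (materialPhase N θ i)⁻¹ * c := fun i => by
    have h2 := congrFun hx i
    rw [genCapacitanceMatrix_mulVec] at h2
    rw [← h2, inv_mul_cancel_left₀ (materialPhase_ne_zero i)]
  have h3 := sum_gaugeWeight_mul_mulVec hγ x
  simp only [h1, ← mul_assoc] at h3
  rw [← Finset.sum_mul, mul_eq_zero] at h3
  rcases h3 with h3 | h3
  · have h4 := congrArg Complex.re h3
    simp only [Complex.re_sum, Complex.re_ofReal_mul, re_inv_materialPhase,
      Complex.zero_re] at h4
    rw [← Finset.sum_mul] at h4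
    exact absurd h4 (mul_pos (gaugeWeight_sum_pos hN) hθ).ne'
  · rw [h3]; rfl

theorem genCapacitanceMatrix_zero_mulVec (x : Fin (2 * N) → ℂ) :
    (genCapacitanceMatrix N 0 γ).mulVec x = (gaugeC N γ).mulVec x := by
  ext i
  rw [genCapacitanceMatrix_mulVec, materialPhase_zero, one_mul]

theorem exists_eigenvector {μ : ℂ} (hμ : (genCapacitanceMatrix N θ γ).charpoly.eval μ = 0) :
    ∃ x ≠ 0, (genCapacitanceMatrix N θ γ).mulVec x = μ • x := by
  rw [← hasEigenvalue_iff_isRoot] at hμ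
  obtain ⟨x, hx, hx0⟩ := hμ.exists_hasEigenvector
  rw [Module.End.mem_eigenspace_iff, Matrix.toLin'_apply] at hx
  exact ⟨x, hx0, hx⟩

/-- At `θ = 0` all eigenvalues are real. -/
theorem conj_eigenvalue_zero (hγ : 0 < γ) {μ : ℂ}
    (hμ : (genCapacitanceMatrix N 0 γ).charpoly.eval μ = 0) : (starRingEnd ℂ) μ = μ := by
  obtain ⟨x, hx0, hx⟩ := exists_eigenvector hμ
  rw [genCapacitanceMatrix_zero_mulVec] at hx
  have h := weightedInner_mulVec hγ x x
  rw [hx, weightedInner_smul_left, weightedInner_smul_right] at h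
  exact (mul_right_cancel₀ (fun h0 => hx0 (weightedInner_self_eq_zero h0)) h).symm

/-- At `θ = 0` all eigenvalues are simple. -/
theorem algMultiplicity_zero_param (hN : 1 ≤ N) (hγ : 0 < γ) {μ : ℂ}
    (hμ : (genCapacitanceMatrix N 0 γ).charpoly.eval μ = 0) : algMultiplicity N γ 0 μ = 1 := by
  refine algMultiplicity_eq_one hN hγ hμ fun x u hx hu => ?_
  rw [genCapacitanceMatrix_zero_mulVec] at hx hu
  have h := weightedInner_mulVec hγ u x
  rw [hx, hu, weightedInner_smul_left, weightedInner_add_right, weightedInner_smul_right,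
    conj_eigenvalue_zero hγ hμ, add_eq_left] at h
  exact weightedInner_self_eq_zero h

/-- At `θ = π / 2` the matrix is skew-adjoint for the Dirichlet form. -/
theorem dirichlet_skew (hγ : 0 < γ) (x y : Fin (2 * N) → ℂ) :
    weightedInner N γ ((genCapacitanceMatrix N (Real.pi / 2) γ).mulVec x)
        ((gaugeC N γ).mulVec y) =
      -weightedInner N γ x
        ((gaugeC N γ).mulVec ((genCapacitanceMatrix N (Real.pi / 2) γ).mulVec y)) := by
  -- Both sides become pairings of `C x` with `C y` through the phases, and conjugating a phase
  -- equal to `±i` changes its sign.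
  rw [weightedInner_mulVec hγ x]
  simp only [weightedInner, ← Finset.sum_neg_distrib, genCapacitanceMatrix_mulVec, map_mul,
    conj_materialPhase, inv_materialPhase_pi_div_two]
  exact Finset.sum_congr rfl fun i _ => by ring

/-- Skewness multiplies the Dirichlet form of an eigenvector by `conj μ` on one side and `-μ` on the
other. If that form vanishes, the eigenvector lies in the kernel and `μ = 0`. -/
theorem conj_eigenvalue_pi_div_two (hγ : 0 < γ) {μ : ℂ}
    (hμ : (genCapacitanceMatrix N (Real.pi / 2) γ).charpoly.eval μ = 0) :
    (starRingEnd ℂ) μ = -μ := by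
  obtain ⟨x, hx0, hx⟩ := exists_eigenvector hμ
  have h := dirichlet_skew hγ x x
  rw [hx, Matrix.mulVec_smul, weightedInner_smul_left, weightedInner_smul_right, ← neg_mul] at h
  by_cases h0 : weightedInner N γ x ((gaugeC N γ).mulVec x) = 0
  · have h1 := genCapacitanceMatrix_mulVec_eq_zero_iff (θ := Real.pi / 2).2
      (mulVec_eq_zero_of_weightedInner_eq_zero hγ h0)
    rw [hx, smul_eq_zero, or_iff_left hx0] at h1
    simp [h1]
  · exact mul_right_cancel₀ h0 h

/-- At `θ = π / 2` all nonzero eigenvalues are simple. -/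
theorem algMultiplicity_pi_div_two (hN : 1 ≤ N) (hγ : 0 < γ) {μ : ℂ} (h0 : μ ≠ 0)
    (hμ : (genCapacitanceMatrix N (Real.pi / 2) γ).charpoly.eval μ = 0) :
    algMultiplicity N γ (Real.pi / 2) μ = 1 := by
  refine algMultiplicity_eq_one hN hγ hμ fun x u hx hu => ?_
  have h := dirichlet_skew hγ u x
  rw [hx, hu, Matrix.mulVec_add, Matrix.mulVec_smul, weightedInner_smul_left,
    weightedInner_add_right, weightedInner_smul_right, conj_eigenvalue_pi_div_two hγ hμ] at h
  have h1 : weightedInner N γ u ((gaugeC N γ).mulVec u) = 0 := by linear_combination h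
  have h2 := genCapacitanceMatrix_mulVec_eq_zero_iff (θ := Real.pi / 2).2
    (mulVec_eq_zero_of_weightedInner_eq_zero hγ h1)
  rw [hu, smul_eq_zero] at h2
  exact h2.resolve_left h0

/-- A vector in the weighted hyperplane lies in the range of the gauge capacitance matrix. -/
theorem exists_mulVec_eq (hN : 1 ≤ N) (hγ : 0 < γ) {y : Fin (2 * N) → ℂ}
    (hy : ∑ i, (gaugeWeight N γ i : ℂ) * y i = 0) : ∃ x, (gaugeC N γ).mulVec x = y := by
  let φ : (Fin (2 * N) → ℂ) →ₗ[ℂ] ℂ :=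
    ∑ i, (gaugeWeight N γ i : ℂ) • LinearMap.proj (R := ℂ) (φ := fun _ : Fin (2 * N) => ℂ) i
  have hφ : ∀ x, φ x = ∑ i, (gaugeWeight N γ i : ℂ) * x i := fun x => by simp [φ]
  have hW : (∑ i, (gaugeWeight N γ i : ℂ)) ≠ 0 := by
    rw [← Complex.ofReal_sum]
    exact Complex.ofReal_ne_zero.2 (gaugeWeight_sum_pos hN).ne'
  -- The rank-one term repairs the kernel of `C`, so `f` is bijective. Since `φ ∘ f` is the total
  -- weight times `φ`, a preimage of a vector with `φ y = 0` also has `φ x = 0`, and there `f` is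
  -- `C`.
  let f : (Fin (2 * N) → ℂ) →ₗ[ℂ] (Fin (2 * N) → ℂ) :=
    (gaugeC N γ).mulVecLin + LinearMap.pi fun _ => φ
  have hf : ∀ x, f x = (gaugeC N γ).mulVec x + fun _ => φ x := fun x => rfl
  have hφf : ∀ x, φ (f x) = (∑ i, (gaugeWeight N γ i : ℂ)) * φ x := fun x => by
    rw [hf, map_add, hφ, sum_gaugeWeight_mul_mulVec hγ, zero_add, hφ, Finset.sum_mul]
  have hinj : Function.Injective f := by
    rw [injective_iff_map_eq_zero]
    intro x hx
    have h1 := hφf x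
    rw [hx, map_zero, eq_comm, mul_eq_zero, or_iff_right hW] at h1
    rw [hf, h1] at hx
    obtain ⟨c, rfl⟩ := eq_const_of_mulVec_eq_zero hγ
      ((add_zero ((gaugeC N γ).mulVec x)).symm.trans hx)
    rw [hφ, ← Finset.sum_mul, mul_eq_zero, or_iff_right hW] at h1
    rw [h1]; rfl
  obtain ⟨x, rfl⟩ := LinearMap.surjective_of_injective hinj y
  have h1 := hφf x
  rw [hφ, hy, eq_comm, mul_eq_zero, or_iff_right hW] at h1
  refine ⟨x, ?_⟩
  rw [hf, h1]
  ext; simp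

/-- The weights are even under index reversal and the phases `±i` are odd, so the weighted sum of
inverse phases vanishes and the solvability condition holds. -/
theorem exists_generalised_eigenvector (hN : 1 ≤ N) (hγ : 0 < γ) :
    ∃ v, (genCapacitanceMatrix N (Real.pi / 2) γ).mulVec v = fun _ => 1 := by
  obtain ⟨v, hv⟩ := exists_mulVec_eq (y := fun i => (materialPhase N (Real.pi / 2) i)⁻¹) hN hγ (by
    have h := Fintype.sum_equiv Fin.revPerm
      (fun i => (gaugeWeight N γ i : ℂ) * (materialPhase N (Real.pi / 2) i)⁻¹)
      (fun i => -((gaugeWeight N γ i : ℂ) * (materialPhase N (Real.pi / 2) i)⁻¹)) (fun i => by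
        simp only [Fin.revPerm_apply]
        rw [gaugeWeight_rev, materialPhase_rev, inv_inv, inv_materialPhase_pi_div_two, mul_neg])
    rw [Finset.sum_neg_distrib] at h
    exact self_eq_neg.1 h)
  refine ⟨v, funext fun i => ?_⟩
  rw [genCapacitanceMatrix_mulVec, hv, mul_inv_cancel₀ (materialPhase_ne_zero i)]

/-- At `θ = π / 2` the eigenvalue `0` has algebraic multiplicity two. -/
theorem algMultiplicity_zero_pi_div_two (hN : 1 ≤ N) (hγ : 0 < γ) :
    algMultiplicity N γ (Real.pi / 2) 0 = 2 := by
  obtain ⟨v, hv⟩ := exists_generalised_eigenvector hN hγ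
  set A := genCapacitanceMatrix N (Real.pi / 2) γ with hA
  have hone : A.mulVec (fun _ => 1) = 0 :=
    genCapacitanceMatrix_mulVec_eq_zero_iff.2 (gaugeC_mulVec_const 1)
  have hzero : (Matrix.toLin' A) - (0 : ℂ) • (1 : Module.End ℂ (Fin (2 * N) → ℂ)) =
      Matrix.toLin' A := by rw [zero_smul, sub_zero]
  -- No chain has length three: skewness turns the Dirichlet form of `A x` into `-⟨x, C A² x⟩`,
  -- which is zero when `A³ x = 0`.
  have hstab : ∀ x, A.mulVec (A.mulVec (A.mulVec x)) = 0 → A.mulVec (A.mulVec x) = 0 := by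
    intro x hx
    rw [genCapacitanceMatrix_mulVec_eq_zero_iff] at hx ⊢
    refine mulVec_eq_zero_of_weightedInner_eq_zero hγ ?_
    rw [hA, dirichlet_skew hγ, ← hA, hx]
    simp [weightedInner]
  have hpow : ∀ x, ((Matrix.toLin' A) ^ 2) x = A.mulVec (A.mulVec x) := fun x => by
    simp [pow_two]
  have hker : LinearMap.ker ((Matrix.toLin' A) ^ 2) =
      LinearMap.ker ((Matrix.toLin' A) ^ (2 + 1)) := by
    ext x
    rw [LinearMap.mem_ker, LinearMap.mem_ker, pow_succ' (Matrix.toLin' A) 2,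
      Module.End.mul_apply, hpow, Matrix.toLin'_apply]
    exact ⟨fun h => by rw [h, Matrix.mulVec_zero], hstab x⟩
  have hspan : Module.End.maxGenEigenspace (Matrix.toLin' A) 0 =
      Submodule.span ℂ (Set.range ![(fun _ => 1 : Fin (2 * N) → ℂ), v]) := by
    ext x
    rw [Module.End.mem_maxGenEigenspace, Matrix.range_cons, Matrix.range_cons, Matrix.range_empty,
      Set.union_empty, Set.singleton_union, Submodule.mem_span_pair, hzero]
    constructor
    · rintro ⟨k, hk⟩
      have h1 : x ∈ LinearMap.ker ((Matrix.toLin' A) ^ (2 + k)) := by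
        rw [LinearMap.mem_ker, pow_add, Module.End.mul_apply, hk, map_zero]
      rw [← Module.End.ker_pow_constant hker k, LinearMap.mem_ker, hpow,
        genCapacitanceMatrix_mulVec_eq_zero_iff] at h1
      obtain ⟨c, hc⟩ := eq_const_of_mulVec_eq_zero hγ h1
      have h2 : A.mulVec (x - c • v) = 0 := by
        rw [Matrix.mulVec_sub, Matrix.mulVec_smul, hc, hv]
        ext; simp
      rw [genCapacitanceMatrix_mulVec_eq_zero_iff] at h2
      obtain ⟨d, hd⟩ := eq_const_of_mulVec_eq_zero hγ h2
      refine ⟨d, c, ?_⟩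
      rw [sub_eq_iff_eq_add.1 hd]
      ext; simp
    · rintro ⟨d, c, rfl⟩
      refine ⟨2, ?_⟩
      rw [hpow]
      simp [Matrix.mulVec_add, Matrix.mulVec_smul, hone, hv]
  have hli : LinearIndependent ℂ ![(fun _ => 1 : Fin (2 * N) → ℂ), v] := by
    rw [LinearIndependent.pair_iff]
    intro d c h
    have h1 := congrArg A.mulVec h
    rw [Matrix.mulVec_add, Matrix.mulVec_smul, Matrix.mulVec_smul, hone, hv, smul_zero, zero_add,
      Matrix.mulVec_zero] at h1
    have hc : c = 0 := by simpa using congrFun h1 ⟨0, by omega⟩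
    subst hc
    exact ⟨by simpa using congrFun h ⟨0, by omega⟩, rfl⟩
  rw [algMultiplicity_eq_finrank, ← hA, hspan, finrank_span_eq_card hli, Fintype.card_fin]

end WeightedForm

/-! ### Exceptional points and the coalescence at `0` -/

section Exceptional

variable {N : ℕ} {γ : ℝ}

/-- Every nonzero eigenvalue at `θ = π / 2` has passed through an exceptional point. -/
theorem hasPassedThroughExceptionalPoint (hN : 1 ≤ N) (hγ : 0 < γ) {μ : ℂ} (h0 : μ ≠ 0)
    (hμ : (genCapacitanceMatrix N (Real.pi / 2) γ).charpoly.eval μ = 0) :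
    HasPassedThroughExceptionalPoint N γ (Real.pi / 2) μ := by
  have hsimple := algMultiplicity_pi_div_two hN hγ h0 hμ
  have hp := contDiff_charpoly_coeff N γ
  have hn := fun θ => (natDegree_charpoly N γ θ).le
  obtain ⟨θ₀, ⟨hθ₀, hθ₀b⟩, q, hqc, hq0, hq, hqb, hend⟩ :=
    exists_maximal_root_path hp hn (fun θ => (Matrix.charpoly_monic _).ne_zero)
      Real.pi_div_two_pos (fun θ z hz => norm_eigenvalue_le hz) hμ
      (algMultiplicity_eq_one_iff.1 hsimple).2
  have hroot : ∀ θ ∈ Icc θ₀ (Real.pi / 2), (genCapacitanceMatrix N θ γ).charpoly.eval (q θ) = 0 := by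
    intro θ hθ
    rcases hθ.1.eq_or_lt with rfl | hlt
    · exact hq0
    · exact hq.2 θ ⟨hlt, hθ.2⟩
  -- A path reaching `θ = 0` is simple and real there, hence equal to its conjugate path throughout,
  -- which an imaginary nonzero endpoint forbids.
  have hne : θ₀ ≠ 0 := by
    rintro rfl
    have hs : ∀ θ ∈ Icc 0 (Real.pi / 2),
        (derivative (genCapacitanceMatrix N θ γ).charpoly).eval (q θ) ≠ 0 := by
      intro θ hθ
      rcases hθ.1.eq_or_lt with rfl | hlt
      · exact (algMultiplicity_eq_one_iff.1 (algMultiplicity_zero_param hN hγ hq0)).2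
      · exact hq.3 θ ⟨hlt, hθ.2⟩
    have heq := eqOn_of_simple_roots hp hn isPreconnected_Icc hqc
      (Complex.continuous_conj.comp_continuousOn hqc) hroot
      (fun θ hθ => charpoly_eval_conj (hroot θ hθ)) hs (left_mem_Icc.2 Real.pi_div_two_pos.le)
      (conj_eigenvalue_zero hγ hq0).symm
    have h1 : q (Real.pi / 2) = (starRingEnd ℂ) (q (Real.pi / 2)) :=
      heq (right_mem_Icc.2 Real.pi_div_two_pos.le)
    rw [hqb, conj_eigenvalue_pi_div_two hγ hμ] at h1
    exact h0 (self_eq_neg.1 h1)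
  refine ⟨hsimple, θ₀, lt_of_le_of_ne hθ₀ hne.symm, hθ₀b, q,
    ⟨hqc, fun θ hθ => (hasEigenvalue_iff_isRoot N γ θ _).2 (hroot θ hθ), hqb⟩, ?_, ?_, ?_⟩
  · intro q' hq'
    -- Simplicity may fail at `θ₀`, so uniqueness is applied on the half-open interval and passes to
    -- `θ₀` by continuity.
    have heq : EqOn q q' (Ioc θ₀ (Real.pi / 2)) :=
      eqOn_of_simple_roots hp hn isPreconnected_Ioc hq.1
        (hq'.continuousOn.mono Ioc_subset_Icc_self) hq.2
        (fun θ hθ => (hasEigenvalue_iff_isRoot N γ θ _).1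
          (hq'.hasEigenvalue θ (Ioc_subset_Icc_self hθ))) hq.3 (right_mem_Ioc.2 hθ₀b)
        (hqb.trans hq'.endpoint.symm)
    exact (heq.of_subset_closure hqc hq'.continuousOn Ioc_subset_Icc_self
      (closure_Ioc hθ₀b.ne).ge).symm
  · intro θ hθ hd
    exact hq.3 θ hθ ((isDefectiveEigenvalue_iff hN hγ (hq.2 θ hθ)).1 hd)
  · exact (isDefectiveEigenvalue_iff hN hγ hq0).2 (hend.resolve_left hne)

/-- Removing the root `0`, present for every `θ`, lowers its multiplicity at `π/2` from two to one,
so the other eigenvalue can be continued as a simple root of the quotient. -/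
theorem charpoly_eq_divX_mul_X (hN : 1 ≤ N) (θ : ℝ) :
    (genCapacitanceMatrix N θ γ).charpoly = (genCapacitanceMatrix N θ γ).charpoly.divX * X := by
  have h := divX_mul_X_add (genCapacitanceMatrix N θ γ).charpoly
  rw [coeff_zero_eq_eval_zero, isRoot_zero hN, C_0, add_zero] at h
  exact h.symm

theorem eval_zero_derivative_charpoly (hN : 1 ≤ N) (θ : ℝ) :
    (derivative (genCapacitanceMatrix N θ γ).charpoly).eval 0 =
      (genCapacitanceMatrix N θ γ).charpoly.divX.eval 0 := by
  conv_lhs => rw [charpoly_eq_divX_mul_X hN θ]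
  simp

theorem isDefectiveEigenvalue_zero (hN : 1 ≤ N) (hγ : 0 < γ) :
    IsDefectiveEigenvalue (genCapacitanceMatrix N (Real.pi / 2) γ) 0 := by
  rw [isDefectiveEigenvalue_iff hN hγ (isRoot_zero hN)]
  by_contra h
  have h1 := algMultiplicity_eq_one_iff.2 ⟨isRoot_zero hN, h⟩
  rw [algMultiplicity_zero_pi_div_two hN hγ] at h1
  omega

/-- A path of nonzero eigenvalues meets the eigenvalue `0` at `θ = π / 2`. -/
theorem exists_path_to_zero (hN : 1 ≤ N) (hγ : 0 < γ) :
    ∃ θ₀ : ℝ, 0 ≤ θ₀ ∧ θ₀ < Real.pi / 2 ∧ ∃ q : ℝ → ℂ,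
      IsEigenvaluePath N γ θ₀ (Real.pi / 2) 0 q ∧
      ∀ θ : ℝ, θ₀ ≤ θ → θ < Real.pi / 2 → q θ ≠ 0 := by
  set p : ℝ → ℂ[X] := fun θ => (genCapacitanceMatrix N θ γ).charpoly.divX with hpdef
  have hp : ∀ k, ContDiff ℝ 1 fun θ => (p θ).coeff k := fun k => by
    simpa only [hpdef, coeff_divX] using contDiff_charpoly_coeff N γ (k + 1)
  have hn : ∀ θ, (p θ).natDegree ≤ 2 * N := fun θ => by
    rw [hpdef, natDegree_divX_eq_natDegree_tsub_one, natDegree_charpoly]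
    omega
  have hpi : (p (Real.pi / 2)).rootMultiplicity 0 = 1 := by
    have h := algMultiplicity_zero_pi_div_two hN hγ
    have h0 : (genCapacitanceMatrix N (Real.pi / 2) γ).charpoly ≠ 0 :=
      (Matrix.charpoly_monic _).ne_zero
    rw [charpoly_eq_divX_mul_X hN] at h0
    rw [algMultiplicity, charpoly_eq_divX_mul_X hN, rootMultiplicity_mul h0] at h
    have hX : rootMultiplicity (0 : ℂ) X = 1 := by
      simpa using rootMultiplicity_X_sub_C_self (x := (0 : ℂ))
    rw [hX] at h
    exact Nat.succ_injective h
  have hp0 : p (Real.pi / 2) ≠ 0 := by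
    intro h
    rw [h, rootMultiplicity_zero] at hpi
    exact zero_ne_one hpi
  obtain ⟨h0, h1⟩ := (rootMultiplicity_eq_one_iff hp0).1 hpi
  obtain ⟨φ, hφc, hφs, hφ⟩ := exists_local_root hp hn h0 h1
  have t : Tendsto (fun θ => (θ, φ θ)) (𝓝 (Real.pi / 2)) (𝓝 (Real.pi / 2, 0)) := by
    have := (continuousAt_id.prodMk hφc.self_of_nhds).tendsto
    simpa [hφs] using this
  obtain ⟨l, hl, hls⟩ := (mem_nhdsLE_iff_exists_Icc_subset).1
    ((hφc.and (t.eventually hφ)).filter_mono nhdsWithin_le_nhds)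
  have hroot : ∀ θ ∈ Icc l (Real.pi / 2), (p θ).eval (φ θ) = 0 := fun θ hθ => (hls hθ).2.2 rfl
  have hsub : Icc (max 0 l) (Real.pi / 2) ⊆ Icc l (Real.pi / 2) :=
    Icc_subset_Icc_left (le_max_right _ _)
  refine ⟨max 0 l, le_max_left _ _, max_lt Real.pi_div_two_pos hl, φ,
    ⟨fun θ hθ => (hls (hsub hθ)).1.continuousWithinAt, fun θ hθ => ?_, hφs⟩,
    fun θ hθ hθ' hz => ?_⟩
  · rw [hasEigenvalue_iff_isRoot, charpoly_eq_divX_mul_X hN, eval_mul, hroot θ (hsub hθ), zero_mul]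
  · have h2 := hroot θ (hsub ⟨hθ, hθ'.le⟩)
    have hcos : 0 < Real.cos θ := Real.cos_pos_of_mem_Ioo
      ⟨by linarith [Real.pi_pos, (le_max_left 0 l).trans hθ], hθ'⟩
    have h3 := (algMultiplicity_eq_one_iff.1 (algMultiplicity_zero_of_cos_pos hN hγ hcos)).2
    rw [hz] at h2
    -- A zero of the path before `π/2` would be a root of the quotient at `0`, making `0` a double
    -- eigenvalue there.
    exact h3 ((eval_zero_derivative_charpoly hN θ).trans h2)

theorem charpoly_roots_pi_div_two (hN : 1 ≤ N) (hγ : 0 < γ) :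
    (genCapacitanceMatrix N (Real.pi / 2) γ).charpoly.roots =
      ((genCapacitanceMatrix N (Real.pi / 2) γ).charpoly.roots.toFinset.erase 0).val + {0, 0} := by
  have hp0 : (genCapacitanceMatrix N (Real.pi / 2) γ).charpoly ≠ 0 :=
    (Matrix.charpoly_monic _).ne_zero
  ext μ
  rw [Multiset.count_add]
  by_cases h0 : μ = 0
  · subst h0
    rw [count_roots, ← algMultiplicity, algMultiplicity_zero_pi_div_two hN hγ,
      Multiset.count_eq_zero_of_notMem (Finset.notMem_erase _ _)]
    simp
  have hz : Multiset.count μ ({0, 0} : Multiset ℂ) = 0 :=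
    Multiset.count_eq_zero_of_notMem (by simpa using h0)
  rw [hz, add_zero]
  by_cases hr : (genCapacitanceMatrix N (Real.pi / 2) γ).charpoly.eval μ = 0
  · rw [count_roots, ← algMultiplicity, algMultiplicity_pi_div_two hN hγ h0 hr,
      Multiset.count_eq_one_of_mem (Finset.nodup _)]
    rw [Finset.mem_val, Finset.mem_erase, Multiset.mem_toFinset, mem_roots hp0]
    exact ⟨h0, hr⟩
  · have hm : μ ∉ (genCapacitanceMatrix N (Real.pi / 2) γ).charpoly.roots := fun h =>
      hr ((mem_roots hp0).1 h)
    rw [Multiset.count_eq_zero_of_notMem hm, Multiset.count_eq_zero_of_notMem]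
    rw [Finset.mem_val, Finset.mem_erase, Multiset.mem_toFinset]
    exact fun h => hm h.2

end Exceptional

end GaugeCapacitance

theorem theorem4p2 (γ : ℝ) (hγ : 0 < γ) (N : ℕ) (hN : 1 ≤ N) :
    -- the `2N` eigenvalues at `θ = π / 2` with multiplicity: the `2N - 2` elements of `S`, and `0, 0`
    (∃ S : Finset ℂ, S.card + 2 = 2 * N ∧
      (GaugeCapacitance.genCapacitanceMatrix N (Real.pi / 2) γ).charpoly.roots
        = S.val + {0, 0} ∧
      ∀ μ ∈ S, μ ≠ 0 ∧ μ.re = 0 ∧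
        GaugeCapacitance.HasPassedThroughExceptionalPoint N γ (Real.pi / 2) μ) ∧
    -- the eigenvalue `0` is exceptional at `θ = π / 2`
    GaugeCapacitance.IsExceptionalPoint N γ (Real.pi / 2) ∧
    GaugeCapacitance.IsDefectiveEigenvalue
      (GaugeCapacitance.genCapacitanceMatrix N (Real.pi / 2) γ) 0 ∧
    -- but it is a simple eigenvalue for `0 ≤ θ < π / 2`
    (∀ θ : ℝ, 0 ≤ θ → θ < Real.pi / 2 → GaugeCapacitance.algMultiplicity N γ θ 0 = 1) ∧
    -- and it meets another path of eigenvalues exactly at `θ = π / 2`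
    (∃ θ₀ : ℝ, 0 ≤ θ₀ ∧ θ₀ < Real.pi / 2 ∧ ∃ q : ℝ → ℂ,
      GaugeCapacitance.IsEigenvaluePath N γ θ₀ (Real.pi / 2) 0 q ∧
      ∀ θ : ℝ, θ₀ ≤ θ → θ < Real.pi / 2 → q θ ≠ 0) := by
  refine ⟨?_, (GaugeCapacitance.not_isDiagonalisable_iff _).2
    ⟨0, GaugeCapacitance.isDefectiveEigenvalue_zero hN hγ⟩,
    GaugeCapacitance.isDefectiveEigenvalue_zero hN hγ, fun θ h0 h1 => ?_,
    GaugeCapacitance.exists_path_to_zero hN hγ⟩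
  · have hroots := GaugeCapacitance.charpoly_roots_pi_div_two hN hγ
    refine ⟨_, ?_, hroots, fun μ hμ => ?_⟩
    · have hcard := congrArg Multiset.card hroots
      rw [IsAlgClosed.card_roots_eq_natDegree, GaugeCapacitance.natDegree_charpoly,
        Multiset.card_add] at hcard
      exact hcard.symm
    · rw [Finset.mem_erase, Multiset.mem_toFinset,
        Polynomial.mem_roots (Matrix.charpoly_monic _).ne_zero] at hμ
      refine ⟨hμ.1, ?_,
        GaugeCapacitance.hasPassedThroughExceptionalPoint hN hγ hμ.1 hμ.2⟩
      have h := congrArg Complex.re (GaugeCapacitance.conj_eigenvalue_pi_div_two hγ hμ.2)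
      rw [Complex.conj_re, Complex.neg_re] at h
      linarith
  · exact GaugeCapacitance.algMultiplicity_zero_of_cos_pos hN hγ
      (Real.cos_pos_of_mem_Ioo ⟨by linarith [Real.pi_pos], h1⟩)
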